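/- Let $Y_1,Y_2,\dots$ be i.i.d. real random variables with a density $f:\mathbb{R}\to[0,\infty)$ that is Lipschitz continuous with constant $L>0$, and let $D=\{y\in\mathbb{R}: f(y)>0\}$. For each sample size $n\ge 1$ let $K=K(n)\ge 1$ and let $\infty=t_0>t_1>t_2>\dots>t_K$ be (deterministic, $n$-dependent) bin thresholds, with bins $I_k=[t_k,t_{k-1})$, $1\le k\le K$. Let $Y_{(1)}\ge\dots\ge Y_{(n)}$ be the descending order statistics of $Y_1,\dots,Y_n$, let $n_0=0$, $n_k=\#\{i: Y_{(i)}\ge t_k\}$, $S_m=\sum_{i=1}^m Y_{(i)}$, and put $\hat q_k=(n_k-n_{k-1})/n$ and $\hat y_k=(S_{n_k}-S_{n_{k-1}})/(n_k-n_{k-1})$ (for an empty bin read $\hat q_k\hat y_k=0$). The maximum-entropy estimator $\hat f$ is the minimizer of $\int_{t_K}^\infty g\log g\,dy$ over the nonnegative integrable functions $g$ on $[t_K,\infty)$ satisfying $\int_{I_k} g\,dy=\hat q_k$ and $\int_{I_k} y\,g(y)\,dy=\hat q_k\hat y_k$ for $k=1,\dots,K$, taken in its version that is continuous on each bin $I_k$,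 and extended by $0$ below $t_K$. Assume that there are constants $c_1,c_2>0$ and $0<r_2\le r_1<1/4$ such that, for all $n\ge1$, $$c_1n^{-r_1}\le t_{k-1}-t_k\le c_2n^{-r_2}\qquad (2\le k\le K),$$ and that $\limsup_{n\to\infty} t_K\le\inf D$ and $\liminf_{n\to\infty}t_1\ge\sup D$ (in $[-\infty,\infty]$). Let $C\subset D$ be compact. Then, almost surely, for every $n\ge1$ the minimization problem has a solution, unique up to null sets, $\hat f$ is well defined, and $\sup_{y\in C}|\hat f(y)-f(y)|<\infty$. As $n\to\infty$, $$\sup_{y\in C}|\hat f(y)-f(y)|\to 0\quad\text{almost surely},$$ and $$\sup_{y\in C}|\hat f(y)-f(y)|=d_n+R_n,\qquad d_n=O(n^{-r_2})\text{ deterministic},\qquad R_n=O_p\!\left(n^{-(1-4r_1)/2}\right).$$ -/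

import Mathlib

open MeasureTheory ProbabilityTheory Filter Topology Asymptotics

noncomputable section

namespace TabulatedME

/-! ### Tabulated summary data

Thresholds are given by `t : ℕ → ℝ`, of which only `t 1 > t 2 > ⋯ > t K` are used; the
threshold with index `0` is `∞` and is treated separately. -/

/-- Order statistics of a sample in descending order; `orderStat y i` is the `(i + 1)`-st largest
value (indices start at `0`). -/
def orderStat {n : ℕ} (y : Fin n → ℝ) (i : Fin n) : ℝ :=
  y (Tuple.sort (fun j => -y j) i)

/-- `S_m`, the sum of the top `m` order statistics (`S_0 = 0`). -/
def partialSum {n : ℕ} (y : Fin n → ℝ) (m : ℕ) : ℝ :=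
  ∑ i : Fin n, if (i : ℕ) < m then orderStat y i else 0

/-- `n_k`, the number of order statistics in the top `k` bins, that is, at or above the `k`-th
threshold; `n_0 = 0` because the threshold with index `0` is `∞`. -/
def topCount {n : ℕ} (y : Fin n → ℝ) (t : ℕ → ℝ) (k : ℕ) : ℕ :=
  if k = 0 then 0 else (Finset.univ.filter (fun i : Fin n => t k ≤ orderStat y i)).card

/-- Empirical bin probability `(n_k - n_{k-1}) / n`, for `k ≥ 1`. -/
def qHat {n : ℕ} (y : Fin n → ℝ) (t : ℕ → ℝ) (k : ℕ) : ℝ :=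
  ((topCount y t k : ℝ) - (topCount y t (k - 1) : ℝ)) / (n : ℝ)

/-- Empirical bin mean `(S_{n_k} - S_{n_{k-1}}) / (n_k - n_{k-1})`, for `k ≥ 1`. In an empty bin
its value is irrelevant, since it only enters multiplied by `qHat y t k = 0`. -/
def yHat {n : ℕ} (y : Fin n → ℝ) (t : ℕ → ℝ) (k : ℕ) : ℝ :=
  (partialSum y (topCount y t k) - partialSum y (topCount y t (k - 1))) /
    ((topCount y t k : ℝ) - (topCount y t (k - 1) : ℝ))

/-! ### The maximum entropy problem -/

/-- The `k`-th bin from the top (`k ≥ 1`): `[t 1, ∞)` for `k = 1`, and `[t k, t (k - 1))` for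
`k ≥ 2`. -/
def bin (t : ℕ → ℝ) (k : ℕ) : Set ℝ :=
  if k = 1 then Set.Ici (t 1) else Set.Ico (t k) (t (k - 1))

/-- `g` is a nonnegative integrable function on `[t K, ∞)` satisfying the moment restrictions
`∫_{I_k} g = q_k` and `∫_{I_k} x g(x) dx = q_k y_k` for `k = 1, …, K`. -/
structure IsFeasible (K : ℕ) (t q y : ℕ → ℝ) (g : ℝ → ℝ) : Prop where
  nonneg : ∀ x ∈ Set.Ici (t K), 0 ≤ g x
  integrable : IntegrableOn g (Set.Ici (t K))
  prob : ∀ k ∈ Set.Icc 1 K, ∫ x in bin t k, g x = q k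
  mean_integrable : ∀ k ∈ Set.Icc 1 K, IntegrableOn (fun x => x * g x) (bin t k)
  mean : ∀ k ∈ Set.Icc 1 K, ∫ x in bin t k, x * g x = q k * y k

/-- `g` solves the maximum entropy problem: it minimizes `∫ g log g` over `[t K, ∞)` subject to the
moment restrictions. For a feasible function the negative part of `h log h` is integrable (its
first moment is finite), so `∫ h log h` is either finite or `+∞`; competitors of the second kind
are never better, and only those with a finite objective are compared. -/
structure IsMESolution (K : ℕ) (t q y : ℕ → ℝ) (g : ℝ → ℝ) : Prop where
  feasible : IsFeasible K t q y g
  finite : IntegrableOn (fun x => g x * Real.log (g x)) (Set.Ici (t K))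
  minimal : ∀ h : ℝ → ℝ, IsFeasible K t q y h →
    IntegrableOn (fun x => h x * Real.log (h x)) (Set.Ici (t K)) →
    ∫ x in Set.Ici (t K), g x * Real.log (g x) ≤ ∫ x in Set.Ici (t K), h x * Real.log (h x)

/-- Solutions of the maximum entropy problem are classes of functions up to null sets; this selects
the representative that is continuous on every bin, extended by `0` below the lowest threshold. -/
structure IsMEDensity (K : ℕ) (t q y : ℕ → ℝ) (g : ℝ → ℝ) : Prop where
  solution : IsMESolution K t q y g
  continuousOn : ∀ k ∈ Set.Icc 1 K, ContinuousOn g (bin t k)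
  zero_below : ∀ x, x < t K → g x = 0

open Classical in
/-- The maximum entropy density with bin probabilities `q` and bin means `y` (and `0` if there is
none). -/
def meDensity (K : ℕ) (t q y : ℕ → ℝ) : ℝ → ℝ :=
  if h : ∃ g : ℝ → ℝ, IsMEDensity K t q y g then h.choose else 0

/-- The maximum entropy density estimator built from the tabulated summary of the sample `y`. -/
def meEstimator {n : ℕ} (K : ℕ) (t : ℕ → ℝ) (y : Fin n → ℝ) : ℝ → ℝ :=
  meDensity K t (qHat y t) (yHat y t)

/-! ### Stochastic order symbol -/

/-- `R n = O_p (b n)` as `n → ∞`. -/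
def IsBigOInProb {Ω : Type*} [MeasurableSpace Ω] (P : Measure Ω) (R : ℕ → Ω → ℝ) (b : ℕ → ℝ) :
    Prop :=
  ∀ ε : ℝ, 0 < ε → ∃ M : ℝ, 0 < M ∧
    ∀ᶠ n in atTop, P {ω | M * |b n| < |R n ω|} ≤ ENNReal.ofReal ε

end TabulatedME

end

/-! The constraints are imposed bin by bin, so the entropy problem splits into one problem per bin.
There, convexity of `h log h` shows that an exponential of an affine function with the right mass
and first moment is the unique minimizer (`IsExpPiece.entropy_le`). Such a function exists when the
bin mean is interior to the bin; for occupied bins this holds almost surely, since a law with a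
density puts no observation on a threshold, and on an empty bin the zero function serves. Gluing the
pieces gives an explicit formula for the estimator (`meDensity_eq_glue`).

For the error, a bounded bin of width `h` is rescaled to `[0, 1]`, where the solution is `Q *
tiltDensity (N / Q)` with `Q` = mass `/ h` and `N` = first moment `/ h ^ 2`. This is Lipschitz in
`(Q, N)` near constant densities (`abs_mul_tiltDensity_sub_le`). Since `f` is Lipschitz, the
population values are `f x` and `f x / 2` up to `L * h`, so the density built from population
moments is within `O(n ^ (-r₂))` of `f` on `C`: this is the deterministic part.

For the stochastic part, Hoeffding's inequality bounds the deviations of a bin's mass and first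
moment by `s` and `h * s`, with `s = n ^ (-1/2 + r₁)`, outside an event of probability at most `4 *
exp (-2 n ^ (2 r₁))`. Only `O(n ^ r₁)` bins meet `C`, so the exceptional events are summable
(`exists_deviation_events`). After rescaling both deviations become `s / h = O(n ^ (-1/2 + 2 r₁))`,
which tends to zero because `r₁ < 1/4`. Borel–Cantelli gives consistency, and the vanishing
probabilities of the exceptional events give the `O_p` rate.

The unbounded top bin affects only existence: `C` eventually lies below `t 1`. -/

noncomputable section

namespace TabulatedME

/-! ### Exponential tilts of the uniform distribution on the unit interval -/

/-- First moment about `m` of the unnormalised exponential tilt `exp (β (u - m))` on `[0, 1]`. -/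
def tiltMoment (m β : ℝ) : ℝ := ∫ u in (0 : ℝ)..1, (u - m) * Real.exp (β * (u - m))

lemma continuous_tiltMoment (m : ℝ) : Continuous (tiltMoment m) := by
  unfold tiltMoment
  apply intervalIntegral.continuous_parametric_intervalIntegral_of_continuous'
  fun_prop

lemma tiltMoment_zero (m : ℝ) : tiltMoment m 0 = 1 / 2 - m := by
  simp [tiltMoment]

lemma tiltMoment_one_sub (m β : ℝ) : tiltMoment (1 - m) (-β) = -tiltMoment m β := by
  unfold tiltMoment
  have h := intervalIntegral.integral_comp_sub_left (a := 0) (b := 1)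
    (fun u : ℝ => (u - (1 - m)) * Real.exp (-β * (u - (1 - m)))) 1
  simp only [sub_zero, sub_self] at h
  rw [← h, ← intervalIntegral.integral_neg]
  congr 1
  ext u
  rw [show -β * (1 - u - (1 - m)) = β * (u - m) by ring]
  ring

/-- The integrand dominates `(u - m) + β * (max (u - m) 0) ^ 2`, by `exp x ≥ 1 + x` where `u ≥ m`
and by `exp ≤ 1` where `u ≤ m`. The chosen `β` makes the quadratic term contribute exactly `|m -
1/2|`. -/
lemma exists_tiltMoment_nonneg {m : ℝ} (hm : m < 1) : ∃ β, 0 ≤ tiltMoment m β := by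
  have hpos : 0 < ∫ u in (0 : ℝ)..1, (max (u - m) 0) ^ 2 := by
    apply intervalIntegral.integral_pos one_pos (by fun_prop) (fun _ _ => sq_nonneg _)
    refine ⟨1, by simp, ?_⟩
    rw [max_eq_left (by linarith)]
    have : 0 < 1 - m := by linarith
    positivity
  set c := ∫ u in (0 : ℝ)..1, (max (u - m) 0) ^ 2 with hc
  set β := |m - 1 / 2| / c with hβ
  have hβ0 : 0 ≤ β := by positivity
  refine ⟨β, ?_⟩
  have h1 : ∫ u in (0 : ℝ)..1, ((u - m) + β * (max (u - m) 0) ^ 2) ≤ tiltMoment m β := by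
    apply intervalIntegral.integral_mono_on zero_le_one
    · apply Continuous.intervalIntegrable; fun_prop
    · apply Continuous.intervalIntegrable; fun_prop
    intro u _
    rcases le_total 0 (u - m) with h | h
    · rw [max_eq_left h]
      nlinarith [Real.add_one_le_exp (β * (u - m))]
    · rw [max_eq_right h]
      have : Real.exp (β * (u - m)) ≤ 1 :=
        Real.exp_le_one_iff.2 (mul_nonpos_of_nonneg_of_nonpos hβ0 h)
      nlinarith
  have h2 : ∫ u in (0 : ℝ)..1, ((u - m) + β * (max (u - m) 0) ^ 2) = 1 / 2 - m + β * c := by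
    rw [intervalIntegral.integral_add, intervalIntegral.integral_const_mul, ← hc]
    · simp
    · apply Continuous.intervalIntegrable; fun_prop
    · apply Continuous.intervalIntegrable; fun_prop
  have h3 : β * c = |m - 1 / 2| := by rw [hβ]; field_simp
  rw [h2, h3] at h1
  linarith [le_abs_self (m - 1 / 2)]

lemma exists_tiltMoment_eq_zero {m : ℝ} (h0 : 0 < m) (h1 : m < 1) : ∃ β, tiltMoment m β = 0 := by
  apply mem_range_of_exists_le_of_exists_ge (continuous_tiltMoment m)
  · obtain ⟨β, hβ⟩ := exists_tiltMoment_nonneg (m := 1 - m) (by linarith)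
    refine ⟨-β, ?_⟩
    have := tiltMoment_one_sub m (-β)
    rw [neg_neg] at this
    linarith
  · exact exists_tiltMoment_nonneg h1

/-- The derivative of `x * exp (a * x)` in `a` is `x ^ 2 * exp (a * x)`, and the exponential is at
least `exp (-1) ≥ 1/3` in this range. Tangent inequalities for `exp` replace differentiation. -/
lemma mul_exp_sub_exp_ge {a b x : ℝ} (hab : b ≤ a) (ha : |a| ≤ 1) (hb : |b| ≤ 1) (hx : |x| ≤ 1) :
    x * Real.exp (b * x) + (a - b) / 3 * x ^ 2 ≤ x * Real.exp (a * x) := by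
  have hlow : ∀ c : ℝ, |c| ≤ 1 → 1 / 3 ≤ Real.exp (c * x) := by
    intro c hc
    have h1 : |c * x| ≤ 1 := by
      rw [abs_mul]; exact mul_le_one₀ hc (abs_nonneg _) hx
    have h2 : Real.exp (-1) ≤ Real.exp (c * x) := Real.exp_le_exp.2 (abs_le.1 h1).1
    have h3 : (1 : ℝ) / 3 ≤ Real.exp (-1) := by
      rw [Real.exp_neg, one_div]
      exact inv_anti₀ (Real.exp_pos _) (by linarith [Real.exp_one_lt_d9])
    linarith
  have key : ∀ p q : ℝ, Real.exp q * (p - q) ≤ Real.exp p - Real.exp q := by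
    intro p q
    have h1 := Real.add_one_le_exp (p - q)
    have h2 : Real.exp p = Real.exp q * Real.exp (p - q) := by rw [← Real.exp_add]; ring_nf
    rw [h2]
    nlinarith [Real.exp_pos q]
  rcases le_total 0 x with h | h
  · have h1 := key (a * x) (b * x)
    have h2 := hlow b hb
    have h3 : 1 / 3 * ((a - b) * x) ≤ Real.exp (b * x) * ((a - b) * x) :=
      mul_le_mul_of_nonneg_right h2 (mul_nonneg (by linarith) h)
    nlinarith
  · have h1 := key (b * x) (a * x)
    have h2 := hlow a ha
    have h3 : 1 / 3 * ((a - b) * (-x)) ≤ Real.exp (a * x) * ((a - b) * (-x)) :=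
      mul_le_mul_of_nonneg_right h2 (mul_nonneg (by linarith) (by linarith))
    nlinarith

/-- The constant is `1/3 * 1/12`, where `1/12` is the variance of the uniform law, the least value
of `∫ (u - m) ^ 2`. -/
lemma tiltMoment_sub_ge {m a b : ℝ} (hm : m ∈ Set.Icc (0 : ℝ) 1) (hab : b ≤ a) (ha : |a| ≤ 1)
    (hb : |b| ≤ 1) : (a - b) / 36 ≤ tiltMoment m a - tiltMoment m b := by
  have h1 : ∫ u in (0 : ℝ)..1, ((u - m) * Real.exp (b * (u - m)) + (a - b) / 3 * (u - m) ^ 2)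
      ≤ tiltMoment m a := by
    apply intervalIntegral.integral_mono_on zero_le_one
    · apply Continuous.intervalIntegrable; fun_prop
    · apply Continuous.intervalIntegrable; fun_prop
    intro u hu
    apply mul_exp_sub_exp_ge hab ha hb
    rw [abs_le]; constructor <;> linarith [hu.1, hu.2, hm.1, hm.2]
  rw [intervalIntegral.integral_add (by apply Continuous.intervalIntegrable; fun_prop)
    (by apply Continuous.intervalIntegrable; fun_prop), intervalIntegral.integral_const_mul] at h1
  have h2 : ∫ u in (0 : ℝ)..1, (u - m) ^ 2 = 1 / 12 + (m - 1 / 2) ^ 2 := by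
    have := intervalIntegral.integral_comp_sub_right (a := 0) (b := 1) (fun u : ℝ => u ^ 2) m
    rw [this, integral_pow]
    ring
  rw [h2] at h1
  have h3 : tiltMoment m b = ∫ u in (0 : ℝ)..1, (u - m) * Real.exp (b * (u - m)) := rfl
  rw [← h3] at h1
  nlinarith [mul_nonneg (sub_nonneg.2 hab) (sq_nonneg (m - 1 / 2))]

open Classical in
/-- The tilting parameter of the tilt of the uniform distribution on `[0, 1]` with mean `m`. -/
def tiltParam (m : ℝ) : ℝ := if h : ∃ β, tiltMoment m β = 0 then h.choose else 0

lemma tiltMoment_tiltParam {m : ℝ} (h0 : 0 < m) (h1 : m < 1) : tiltMoment m (tiltParam m) = 0 := by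
  have h := exists_tiltMoment_eq_zero h0 h1
  rw [tiltParam, dif_pos h]
  exact h.choose_spec

lemma tiltMoment_strictMono {m : ℝ} : StrictMono (tiltMoment m) := by
  intro b a hab
  unfold tiltMoment
  rw [← sub_pos, ← intervalIntegral.integral_sub (by apply Continuous.intervalIntegrable; fun_prop)
    (by apply Continuous.intervalIntegrable; fun_prop)]
  have hnn : ∀ x : ℝ, 0 ≤ x * Real.exp (a * x) - x * Real.exp (b * x) := by
    intro x
    rw [← mul_sub]
    rcases le_total 0 x with h | h
    · exact mul_nonneg h (sub_nonneg.2 (Real.exp_le_exp.2 (by nlinarith)))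
    · exact mul_nonneg_of_nonpos_of_nonpos h (sub_nonpos.2 (Real.exp_le_exp.2 (by nlinarith)))
  have hne : ∀ x : ℝ, x ≠ 0 → 0 ≠ x * Real.exp (a * x) - x * Real.exp (b * x) := by
    intro x hx h
    rw [← mul_sub] at h
    rcases mul_eq_zero.1 h.symm with h | h
    · exact hx h
    · have := Real.exp_injective (sub_eq_zero.1 h)
      exact absurd (mul_right_cancel₀ hx this) hab.ne'
  apply intervalIntegral.integral_pos one_pos (by fun_prop) (fun u _ => hnn (u - m))
  by_cases hm : m = 0
  · exact ⟨1, by simp, lt_of_le_of_ne (hnn _) (hne _ (by rw [hm]; norm_num))⟩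
  · exact ⟨0, by simp, lt_of_le_of_ne (hnn _) (hne _ (by simpa using hm))⟩

/-- The tilt moment at `β = 0` is `1/2 - m` and its slope on `[-1, 1]` is at least `1/36`, so the
zero cannot leave that interval. -/
lemma abs_tiltParam_le_one {m : ℝ} (hm : |m - 1 / 2| ≤ 1 / 36) : |tiltParam m| ≤ 1 := by
  rw [abs_le] at hm
  have hm' : m ∈ Set.Icc (0 : ℝ) 1 := ⟨by linarith, by linarith⟩
  have hz := tiltMoment_tiltParam (m := m) (by linarith) (by linarith)
  have h0 := tiltMoment_zero m
  have h1 := tiltMoment_sub_ge (a := 1) (b := 0) hm' zero_le_one (by simp) (by simp)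
  have h2 := tiltMoment_sub_ge (a := 0) (b := -1) hm' (by norm_num) (by simp) (by simp)
  rw [abs_le]
  constructor
  · rw [← tiltMoment_strictMono.le_iff_le (a := -1) (b := tiltParam m)]; linarith
  · rw [← tiltMoment_strictMono.le_iff_le (b := 1) (a := tiltParam m)]; linarith

lemma exp_le_three {x : ℝ} (hx : x ≤ 1) : Real.exp x ≤ 3 :=
  (Real.exp_le_exp.2 hx).trans (by linarith [Real.exp_one_lt_d9])

lemma third_le_exp {x : ℝ} (hx : -1 ≤ x) : 1 / 3 ≤ Real.exp x := by
  have := exp_le_three (x := -x) (by linarith)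
  rw [Real.exp_neg] at this
  rw [one_div]
  exact inv_le_of_inv_le₀ (Real.exp_pos _) this

/-- Evaluated at the parameter of `m'`, the tilt moment about `m` is `m' - m` times an integral of
size at most `3`. Dividing by the slope `1/36` gives `108 = 3 * 36`. -/
lemma abs_tiltParam_sub_le {m m' : ℝ} (hm : |m - 1 / 2| ≤ 1 / 36) (hm' : |m' - 1 / 2| ≤ 1 / 36) :
    |tiltParam m - tiltParam m'| ≤ 108 * |m - m'| := by
  have main : ∀ m m' : ℝ, |m - 1 / 2| ≤ 1 / 36 → |m' - 1 / 2| ≤ 1 / 36 →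
      tiltParam m' ≤ tiltParam m → tiltParam m - tiltParam m' ≤ 108 * |m - m'| := by
    intro m m' hm hm' hle
    have hb := abs_tiltParam_le_one hm
    have hb' := abs_tiltParam_le_one hm'
    rw [abs_le] at hm hm'
    have hz := tiltMoment_tiltParam (m := m) (by linarith) (by linarith)
    have hz' := tiltMoment_tiltParam (m := m') (by linarith) (by linarith)
    have h1 := tiltMoment_sub_ge (m := m) ⟨by linarith, by linarith⟩ hle hb hb'
    set β := tiltParam m'
    have hbd : ∀ u ∈ Set.Icc (0 : ℝ) 1, ∀ n ∈ Set.Icc (0 : ℝ) 1, Real.exp (β * (u - n)) ≤ 3 := by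
      intro u hu n hn
      apply exp_le_three
      have : |u - n| ≤ 1 := by rw [abs_le]; constructor <;> linarith [hu.1, hu.2, hn.1, hn.2]
      exact (le_abs_self _).trans (by rw [abs_mul]; exact mul_le_one₀ hb' (abs_nonneg _) this)
    -- Changing the centre of the exponent only multiplies by a constant, so the first moment about
    -- `m'` still vanishes.
    have hmean : ∫ u in (0 : ℝ)..1, (u - m') * Real.exp (β * (u - m)) = 0 := by
      have : ∀ u : ℝ, (u - m') * Real.exp (β * (u - m)) =
          Real.exp (β * (m' - m)) * ((u - m') * Real.exp (β * (u - m'))) := by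
        intro u
        rw [show β * (u - m) = β * (m' - m) + β * (u - m') by ring, Real.exp_add]
        ring
      simp_rw [this]
      rw [intervalIntegral.integral_const_mul]
      unfold tiltMoment at hz'
      rw [hz', mul_zero]
    have h2 : tiltMoment m β = (m' - m) * ∫ u in (0 : ℝ)..1, Real.exp (β * (u - m)) := by
      rw [← intervalIntegral.integral_const_mul]
      have h := intervalIntegral.integral_add (μ := volume) (a := 0) (b := 1)
        (f := fun u : ℝ => (m' - m) * Real.exp (β * (u - m)))
        (g := fun u : ℝ => (u - m') * Real.exp (β * (u - m)))
        (by apply Continuous.intervalIntegrable; fun_prop)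
        (by apply Continuous.intervalIntegrable; fun_prop)
      rw [hmean, add_zero] at h
      rw [← h]
      unfold tiltMoment
      congr 1
      ext u
      ring
    have h3 : ∫ u in (0 : ℝ)..1, Real.exp (β * (u - m)) ≤ ∫ u in (0 : ℝ)..1, (3 : ℝ) := by
      apply intervalIntegral.integral_mono_on zero_le_one
        (by apply Continuous.intervalIntegrable; fun_prop)
        (by apply Continuous.intervalIntegrable; fun_prop)
      intro u hu
      exact hbd u hu m ⟨by linarith, by linarith⟩
    have h4 : 0 ≤ ∫ u in (0 : ℝ)..1, Real.exp (β * (u - m)) :=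
      intervalIntegral.integral_nonneg zero_le_one (fun _ _ => (Real.exp_pos _).le)
    simp only [intervalIntegral.integral_const, sub_zero, one_smul] at h3
    have h5 : -tiltMoment m β ≤ |m - m'| * 3 := by
      rw [h2, ← neg_mul, neg_sub]
      exact (mul_le_mul_of_nonneg_right (le_abs_self _) h4).trans
        (mul_le_mul_of_nonneg_left h3 (abs_nonneg _))
    linarith
  rcases le_total (tiltParam m') (tiltParam m) with h | h
  · rw [abs_of_nonneg (sub_nonneg.2 h)]
    exact main m m' hm hm' h
  · rw [abs_sub_comm, abs_sub_comm m, abs_of_nonneg (sub_nonneg.2 h)]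
    exact main m' m hm' hm h

/-! ### Lipschitz dependence of the tilted density on its mean -/

/-- Normalising constant of the tilt of the uniform distribution on `[0, 1]` by `exp (β u)`. -/
def tiltNorm (β : ℝ) : ℝ := ∫ v in (0 : ℝ)..1, Real.exp (β * v)

/-- The maximum entropy density on `[0, 1]` with mean `m`. -/
def tiltDensity (m u : ℝ) : ℝ := Real.exp (tiltParam m * u) / tiltNorm (tiltParam m)

lemma tiltNorm_pos (β : ℝ) : 0 < tiltNorm β :=
  intervalIntegral.integral_pos one_pos (by fun_prop) (fun _ _ => (Real.exp_pos _).le)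
    ⟨0, by simp, Real.exp_pos _⟩

lemma continuous_tiltDensity (m : ℝ) : Continuous (tiltDensity m) := by
  unfold tiltDensity; fun_prop

lemma tiltDensity_pos (m u : ℝ) : 0 < tiltDensity m u := div_pos (Real.exp_pos _) (tiltNorm_pos _)

lemma integral_tiltDensity (m : ℝ) : ∫ u in (0 : ℝ)..1, tiltDensity m u = 1 := by
  unfold tiltDensity
  rw [intervalIntegral.integral_div]
  exact div_self (tiltNorm_pos _).ne'

lemma integral_mul_tiltDensity {m : ℝ} (h0 : 0 < m) (h1 : m < 1) :
    ∫ u in (0 : ℝ)..1, u * tiltDensity m u = m := by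
  have h := tiltMoment_tiltParam h0 h1
  set β := tiltParam m with hβ
  have e : ∀ u : ℝ, (u - m) * Real.exp (β * (u - m)) =
      (Real.exp (-(β * m)) * tiltNorm β) * (u * tiltDensity m u - m * tiltDensity m u) := by
    intro u
    unfold tiltDensity
    rw [← hβ, show β * (u - m) = -(β * m) + β * u by ring, Real.exp_add]
    field_simp [(tiltNorm_pos β).ne']
  unfold tiltMoment at h
  simp_rw [e] at h
  have hc := continuous_tiltDensity m
  rw [intervalIntegral.integral_const_mul, intervalIntegral.integral_sub
    (by apply Continuous.intervalIntegrable; fun_prop)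
    (by apply Continuous.intervalIntegrable; fun_prop), intervalIntegral.integral_const_mul,
    integral_tiltDensity] at h
  have := (mul_pos (Real.exp_pos (-(β * m))) (tiltNorm_pos β)).ne'
  rcases mul_eq_zero.1 h with h | h
  · exact absurd h this
  · linarith

lemma abs_exp_sub_exp_le {p q : ℝ} (hp : p ≤ 1) (hq : q ≤ 1) :
    |Real.exp p - Real.exp q| ≤ 3 * |p - q| := by
  have main : ∀ p q : ℝ, p ≤ 1 → q ≤ p → Real.exp p - Real.exp q ≤ 3 * (p - q) := by
    intro p q hp hqp
    have h1 := Real.add_one_le_exp (q - p)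
    have h2 : Real.exp q = Real.exp p * Real.exp (q - p) := by rw [← Real.exp_add]; ring_nf
    have h3 := exp_le_three hp
    rw [h2]
    nlinarith [Real.exp_pos p]
  rcases le_total q p with h | h
  · rw [abs_of_nonneg (sub_nonneg.2 (Real.exp_le_exp.2 h)), abs_of_nonneg (sub_nonneg.2 h)]
    exact main p q hp h
  · rw [abs_sub_comm, abs_sub_comm p, abs_of_nonneg (sub_nonneg.2 (Real.exp_le_exp.2 h)),
      abs_of_nonneg (sub_nonneg.2 h)]
    exact main q p hq h

lemma third_le_tiltNorm {β : ℝ} (hβ : |β| ≤ 1) : 1 / 3 ≤ tiltNorm β := by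
  have : ∫ u in (0 : ℝ)..1, (1 / 3 : ℝ) ≤ tiltNorm β := by
    apply intervalIntegral.integral_mono_on zero_le_one
      (by apply Continuous.intervalIntegrable; fun_prop)
      (by apply Continuous.intervalIntegrable; fun_prop)
    intro u hu
    apply third_le_exp
    have := abs_le.1 hβ
    nlinarith [hu.1, hu.2]
  simpa using this

lemma abs_tiltNorm_sub_le {β β' : ℝ} (hβ : |β| ≤ 1) (hβ' : |β'| ≤ 1) :
    |tiltNorm β - tiltNorm β'| ≤ 3 * |β - β'| := by
  unfold tiltNorm
  rw [← intervalIntegral.integral_sub (by apply Continuous.intervalIntegrable; fun_prop)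
    (by apply Continuous.intervalIntegrable; fun_prop)]
  have := intervalIntegral.norm_integral_le_of_norm_le_const (a := 0) (b := 1)
    (C := 3 * |β - β'|) (f := fun u : ℝ => Real.exp (β * u) - Real.exp (β' * u)) ?_
  · simpa using this
  intro u hu
  rw [Set.uIoc_of_le zero_le_one] at hu
  have h1 := abs_le.1 hβ
  have h2 := abs_le.1 hβ'
  refine (abs_exp_sub_exp_le (by nlinarith [hu.1, hu.2]) (by nlinarith [hu.1, hu.2])).trans ?_
  rw [← sub_mul, abs_mul, abs_of_pos hu.1]
  nlinarith [abs_nonneg (β - β'), hu.2]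

lemma tiltDensity_le {m u : ℝ} (hm : |m - 1 / 2| ≤ 1 / 36) (hu : u ∈ Set.Icc (0 : ℝ) 1) :
    tiltDensity m u ≤ 9 := by
  have hb := abs_tiltParam_le_one hm
  have h1 := third_le_tiltNorm hb
  unfold tiltDensity
  rw [div_le_iff₀ (tiltNorm_pos _)]
  have : Real.exp (tiltParam m * u) ≤ 3 := by
    apply exp_le_three
    have := abs_le.1 hb
    nlinarith [hu.1, hu.2]
  linarith

/-- Quotient rule for differences: numerator and normaliser are `3`-Lipschitz in the parameter, the
density is at most `9` and the normaliser at least `1/3`. Hence `(3 + 9 * 3) * 3 * 108 = 9720`. -/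
lemma abs_tiltDensity_sub_le {m m' u : ℝ} (hm : |m - 1 / 2| ≤ 1 / 36)
    (hm' : |m' - 1 / 2| ≤ 1 / 36) (hu : u ∈ Set.Icc (0 : ℝ) 1) :
    |tiltDensity m u - tiltDensity m' u| ≤ 9720 * |m - m'| := by
  have hb := abs_tiltParam_le_one hm
  have hb' := abs_tiltParam_le_one hm'
  have hΔ := abs_tiltParam_sub_le hm hm'
  have h9 := tiltDensity_le hm' hu
  have h9' := tiltDensity_pos m' u
  have hZ := third_le_tiltNorm hb
  have hZZ := abs_tiltNorm_sub_le hb hb'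
  unfold tiltDensity at h9 h9' ⊢
  set β := tiltParam m
  set β' := tiltParam m'
  set p' := Real.exp (β' * u) / tiltNorm β' with hp'
  have hE : |Real.exp (β * u) - Real.exp (β' * u)| ≤ 3 * |β - β'| := by
    have h1 := abs_le.1 hb
    have h2 := abs_le.1 hb'
    refine (abs_exp_sub_exp_le (by nlinarith [hu.1, hu.2]) (by nlinarith [hu.1, hu.2])).trans ?_
    rw [← sub_mul, abs_mul, abs_of_nonneg hu.1]
    nlinarith [abs_nonneg (β - β'), hu.2]
  have hpos := tiltNorm_pos β
  have hpos' := tiltNorm_pos β'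
  have e : Real.exp (β * u) / tiltNorm β - p' =
      ((Real.exp (β * u) - Real.exp (β' * u)) - p' * (tiltNorm β - tiltNorm β')) / tiltNorm β := by
    rw [hp']; field_simp; ring
  rw [e, abs_div, abs_of_pos hpos, div_le_iff₀ hpos]
  have h1 : |(Real.exp (β * u) - Real.exp (β' * u)) - p' * (tiltNorm β - tiltNorm β')| ≤
      3 * |β - β'| + 9 * (3 * |β - β'|) := by
    refine (abs_sub _ _).trans (add_le_add hE ?_)
    rw [abs_mul, abs_of_pos h9']
    exact mul_le_mul h9 hZZ (abs_nonneg _) (by norm_num)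
  have h2 : 9720 * |m - m'| * (1 / 3) ≤ 9720 * |m - m'| * tiltNorm β :=
    mul_le_mul_of_nonneg_left hZ (by positivity)
  linarith

/-- Scaled maximum entropy densities on the unit interval, as functions of the mass `Q` and of the
first moment `N`, are Lipschitz near constant densities. -/
lemma abs_mul_tiltDensity_sub_le {δ B Q Q' N N' η u : ℝ} (hδ : 0 < δ) (hQ' : δ ≤ Q') (hB : Q' ≤ B)
    (hQ : |Q - Q'| ≤ η) (hN : |N - N'| ≤ η) (hN' : |N' - Q' / 2| ≤ δ / 72) (hη : η ≤ δ / 288)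
    (hu : u ∈ Set.Icc (0 : ℝ) 1) :
    |Q * tiltDensity (N / Q) u - Q' * tiltDensity (N' / Q') u| ≤
      (9 + 38880 * B / δ) * η := by
  have hQ'pos : 0 < Q' := hδ.trans_le hQ'
  have hη0 : 0 ≤ η := (abs_nonneg _).trans hQ
  have hQlow : δ / 2 ≤ Q := by linarith [(abs_le.1 hQ).1]
  have hQpos : 0 < Q := by linarith
  -- The admissible distance `1/36` from the mean `1/2` is split evenly between the reference mean
  -- and the perturbation, the latter being at most `4 / δ * (δ / 288)`.
  have hm' : |N' / Q' - 1 / 2| ≤ 1 / 72 := by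
    rw [show N' / Q' - 1 / 2 = (N' - Q' / 2) / Q' by field_simp, abs_div, abs_of_pos hQ'pos,
      div_le_iff₀ hQ'pos]
    linarith
  set m' := N' / Q' with hm'def
  have hNm : N' = m' * Q' := by rw [hm'def]; field_simp
  have hmm : |N / Q - m'| ≤ 4 / δ * η := by
    rw [show N / Q - m' = ((N - N') - m' * (Q - Q')) / Q by rw [hNm]; field_simp; ring, abs_div,
      abs_of_pos hQpos, div_le_iff₀ hQpos]
    have h1 : |m'| ≤ 1 := by
      rw [abs_le] at hm' ⊢; constructor <;> linarith
    have h2 : |(N - N') - m' * (Q - Q')| ≤ η + 1 * η := by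
      refine (abs_sub _ _).trans (add_le_add hN ?_)
      rw [abs_mul]
      exact mul_le_mul h1 hQ (abs_nonneg _) zero_le_one
    have h3 : 4 / δ * η * (δ / 2) ≤ 4 / δ * η * Q := mul_le_mul_of_nonneg_left hQlow (by positivity)
    have h4 : 4 / δ * η * (δ / 2) = 2 * η := by field_simp; ring
    linarith
  have hm : |N / Q - 1 / 2| ≤ 1 / 36 := by
    have h1 : 4 / δ * η ≤ 4 / δ * (δ / 288) := mul_le_mul_of_nonneg_left hη (by positivity)
    have h2 : 4 / δ * (δ / 288) = 1 / 72 := by field_simp; norm_num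
    calc |N / Q - 1 / 2| = |(N / Q - m') + (m' - 1 / 2)| := by ring_nf
      _ ≤ |N / Q - m'| + |m' - 1 / 2| := abs_add_le _ _
      _ ≤ 1 / 36 := by linarith
  have hd := abs_tiltDensity_sub_le hm (hm'.trans (by norm_num)) hu
  have h9 := tiltDensity_le hm hu
  rw [show Q * tiltDensity (N / Q) u - Q' * tiltDensity m' u =
    (Q - Q') * tiltDensity (N / Q) u + Q' * (tiltDensity (N / Q) u - tiltDensity m' u) by ring]
  refine (abs_add_le _ _).trans ?_
  rw [abs_mul, abs_mul, abs_of_pos hQ'pos, abs_of_pos (tiltDensity_pos _ _)]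
  have h1 : |Q - Q'| * tiltDensity (N / Q) u ≤ η * 9 :=
    mul_le_mul hQ h9 (tiltDensity_pos _ _).le hη0
  have h2 : Q' * |tiltDensity (N / Q) u - tiltDensity m' u| ≤ B * (9720 * (4 / δ * η)) :=
    mul_le_mul hB (hd.trans (mul_le_mul_of_nonneg_left hmm (by norm_num))) (abs_nonneg _)
      (hQ'pos.le.trans hB)
  have h3 : B * (9720 * (4 / δ * η)) = 38880 * B / δ * η := by ring
  linarith

/-- This identifies a constant density as the reference point for the approximation error. -/
lemma tiltDensity_half {u : ℝ} : tiltDensity (1 / 2) u = 1 := by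
  have h0 : tiltMoment (1 / 2) 0 = 0 := by rw [tiltMoment_zero]; norm_num
  have h : tiltParam (1 / 2) = 0 := tiltMoment_strictMono.injective
    ((tiltMoment_tiltParam (by norm_num) (by norm_num)).trans h0.symm)
  simp only [tiltDensity, tiltNorm, h]
  simp

/-! ### Geometry of the bins -/

lemma measurableSet_bin (t : ℕ → ℝ) (k : ℕ) : MeasurableSet (bin t k) := by
  unfold bin
  split_ifs
  · exact measurableSet_Ici
  · exact measurableSet_Ico

lemma le_of_mem_bin {t : ℕ → ℝ} {k : ℕ} {x : ℝ} (hx : x ∈ bin t k) : t k ≤ x := by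
  unfold bin at hx
  split_ifs at hx with h
  · rw [h]; exact hx
  · exact hx.1

lemma lt_of_mem_bin {t : ℕ → ℝ} {k : ℕ} {x : ℝ} (hk : k ≠ 1) (hx : x ∈ bin t k) :
    x < t (k - 1) := by
  rw [bin, if_neg hk] at hx
  exact hx.2

lemma bin_of_two_le (t : ℕ → ℝ) {k : ℕ} (hk : 2 ≤ k) : bin t k = Set.Ico (t k) (t (k - 1)) := by
  rw [bin, if_neg (by omega)]

lemma bin_one (t : ℕ → ℝ) : bin t 1 = Set.Ici (t 1) := by simp [bin]

section Bins

variable {K : ℕ} {t q y : ℕ → ℝ}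

lemma not_mem_bin_of_lt (ht : StrictAntiOn t (Set.Icc 1 K)) {j k : ℕ} (hj : 1 ≤ j) (hk : k ≤ K)
    (hjk : j < k) {x : ℝ} (hx : x ∈ bin t j) : x ∉ bin t k := by
  intro hx'
  have h1 := le_of_mem_bin hx
  have h2 := lt_of_mem_bin (by omega) hx'
  have h3 : t (k - 1) ≤ t j :=
    ht.antitoneOn ⟨hj, by omega⟩ ⟨by omega, by omega⟩ (by omega : j ≤ k - 1)
  linarith

lemma eq_of_mem_bin (ht : StrictAntiOn t (Set.Icc 1 K)) {j k : ℕ} (hj : j ∈ Set.Icc 1 K)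
    (hk : k ∈ Set.Icc 1 K) {x : ℝ} (hxj : x ∈ bin t j) (hxk : x ∈ bin t k) : j = k := by
  rcases lt_trichotomy j k with h | h | h
  · exact absurd hxk (not_mem_bin_of_lt ht hj.1 hk.2 h hxj)
  · exact h
  · exact absurd hxj (not_mem_bin_of_lt ht hk.1 hj.2 h hxk)

lemma exists_mem_bin (hK : 1 ≤ K) {x : ℝ} (hx : t K ≤ x) : ∃ k ∈ Set.Icc 1 K, x ∈ bin t k := by
  induction K, hK using Nat.le_induction with
  | base => exact ⟨1, by simp, by rw [bin_one]; exact hx⟩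
  | succ K hK ih =>
    rcases le_or_gt (t K) x with h | h
    · obtain ⟨k, hk, hxk⟩ := ih h
      exact ⟨k, ⟨hk.1, by have := hk.2; omega⟩, hxk⟩
    · refine ⟨K + 1, ⟨by omega, le_rfl⟩, ?_⟩
      rw [bin_of_two_le t (by omega)]
      exact ⟨hx, by simpa using h⟩

lemma bin_subset_Ici (ht : StrictAntiOn t (Set.Icc 1 K)) {k : ℕ} (hk : k ∈ Set.Icc 1 K) :
    bin t k ⊆ Set.Ici (t K) := fun _ hx =>
  (ht.antitoneOn hk ⟨hk.1.trans hk.2, le_rfl⟩ hk.2).trans (le_of_mem_bin hx)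

lemma biUnion_bin (hK : 1 ≤ K) (ht : StrictAntiOn t (Set.Icc 1 K)) :
    ⋃ k ∈ Finset.Icc 1 K, bin t k = Set.Ici (t K) := by
  ext x
  simp only [Set.mem_iUnion, exists_prop, Set.mem_Ici, Finset.mem_Icc]
  constructor
  · rintro ⟨k, hk, hx⟩
    exact bin_subset_Ici ht hk hx
  · intro hx
    exact exists_mem_bin hK hx

lemma pairwise_disjoint_bin (ht : StrictAntiOn t (Set.Icc 1 K)) :
    (↑(Finset.Icc 1 K) : Set ℕ).Pairwise (Function.onFun Disjoint (bin t)) := by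
  intro j hj k hk hjk
  rw [Function.onFun, Set.disjoint_left]
  intro x hxj hxk
  exact hjk (eq_of_mem_bin ht (by simpa using hj) (by simpa using hk) hxj hxk)

lemma integral_Ici_eq_sum_bin (hK : 1 ≤ K) (ht : StrictAntiOn t (Set.Icc 1 K)) {φ : ℝ → ℝ}
    (hφ : IntegrableOn φ (Set.Ici (t K))) :
    ∫ x in Set.Ici (t K), φ x = ∑ k ∈ Finset.Icc 1 K, ∫ x in bin t k, φ x := by
  have h := integral_biUnion_finset (f := φ) (μ := volume) (Finset.Icc 1 K)
    (fun k _ => measurableSet_bin t k) (pairwise_disjoint_bin ht)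
    (fun k hk => hφ.mono_set (bin_subset_Ici ht (by simpa using hk)))
  rwa [biUnion_bin hK ht] at h

lemma integrableOn_Ici_of_bin (hK : 1 ≤ K) (ht : StrictAntiOn t (Set.Icc 1 K)) {φ : ℝ → ℝ}
    (hφ : ∀ k ∈ Set.Icc 1 K, IntegrableOn φ (bin t k)) : IntegrableOn φ (Set.Ici (t K)) := by
  rw [← biUnion_bin hK ht, integrableOn_finset_iUnion]
  intro k hk
  exact hφ k (by simpa using hk)

/-- Needed so that almost everywhere equal functions, continuous on a bin, agree at every point of
it, the left endpoint included. -/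
lemma bin_subset_closure_interior (ht : StrictAntiOn t (Set.Icc 1 K)) {k : ℕ}
    (hk : k ∈ Set.Icc 1 K) : bin t k ⊆ closure (interior (bin t k)) := by
  rcases eq_or_ne k 1 with rfl | h1
  · rw [bin_one, interior_Ici, closure_Ioi]
  · have h2 : 2 ≤ k := by have := hk.1; omega
    have hlt : t k < t (k - 1) := ht ⟨by omega, by have := hk.2; omega⟩ hk (by omega)
    rw [bin_of_two_le t h2, interior_Ico, closure_Ioo hlt.ne]
    exact Set.Ico_subset_Icc_self

/-! ### Exponential families on a single bin -/

/-- `g` is a bounded continuous density on `s` with mass `q` and first moment `q * y`, which is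
either zero or the exponential of an affine function. -/
structure IsExpPiece (s : Set ℝ) (q y : ℝ) (g : ℝ → ℝ) : Prop where
  continuous : Continuous g
  nonneg : ∀ x, 0 ≤ g x
  bounded : ∃ B, ∀ x ∈ s, g x ≤ B
  integrableOn : IntegrableOn g s
  mass : ∫ x in s, g x = q
  integrableOn_mul : IntegrableOn (fun x => x * g x) s
  moment : ∫ x in s, x * g x = q * y
  form : (∀ x, g x = 0) ∨ ∃ α β : ℝ, ∀ x, g x = Real.exp (α + β * x)

/-- This is the Bregman divergence of `h log h`; for `h > 0` it is `h * (r - 1 - log r)` with `r = g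
/ h`. At `h = 0` the convention `log 0 = 0` gives the correct value `g > 0`. -/
lemma mul_log_ge {h g a : ℝ} (hh : 0 ≤ h) (hg : g = Real.exp a) :
    0 ≤ h * Real.log h - a * h - h + g ∧ (h * Real.log h - a * h - h + g = 0 → h = g) := by
  rcases hh.eq_or_lt with rfl | hpos
  · have := Real.exp_pos a
    simp only [zero_mul, mul_zero, sub_zero, zero_add]
    exact ⟨hg ▸ this.le, fun h => h.symm⟩
  · have hgp : 0 < g := hg ▸ Real.exp_pos a
    have hlog : Real.log (g / h) = a - Real.log h := by
      rw [Real.log_div hgp.ne' hpos.ne', hg, Real.log_exp]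
    have e : h * Real.log h - a * h - h + g = h * ((g / h - 1) - Real.log (g / h)) := by
      rw [hlog]; field_simp; ring
    rw [e]
    have hd : 0 < g / h := div_pos hgp hpos
    refine ⟨mul_nonneg hpos.le (sub_nonneg.2 (Real.log_le_sub_one_of_pos hd)), fun h0 => ?_⟩
    by_contra hne
    have h1 : g / h ≠ 1 := fun h1 => hne ((div_eq_one_iff_eq hpos.ne').1 h1).symm
    have := Real.log_lt_sub_one_of_pos hd h1
    have := mul_pos hpos (sub_pos.2 this)
    linarith

namespace IsExpPiece

variable {s : Set ℝ} {a b : ℝ} {g : ℝ → ℝ}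

lemma integrableOn_mul_log (hg : IsExpPiece s a b g) :
    IntegrableOn (fun x => g x * Real.log (g x)) s := by
  rcases hg.form with h0 | ⟨α, β, hαβ⟩
  · simp [h0]
  · have e : (fun x => g x * Real.log (g x)) = fun x => α * g x + β * (x * g x) := by
      ext x; rw [hαβ, Real.log_exp]; ring
    rw [e]
    exact (hg.integrableOn.const_mul α).add (hg.integrableOn_mul.const_mul β)

/-- Among densities with the same mass and first moment, an exponential piece uniquely minimizes
`∫ h log h`. -/
lemma entropy_le (hg : IsExpPiece s a b g) (hs : MeasurableSet s) {h : ℝ → ℝ}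
    (hnn : ∀ x ∈ s, 0 ≤ h x) (hint : IntegrableOn h s) (hmass : ∫ x in s, h x = a)
    (hxint : IntegrableOn (fun x => x * h x) s) (hmean : ∫ x in s, x * h x = a * b)
    (hlog : IntegrableOn (fun x => h x * Real.log (h x)) s) :
    ∫ x in s, g x * Real.log (g x) ≤ ∫ x in s, h x * Real.log (h x) ∧
    (∫ x in s, g x * Real.log (g x) = ∫ x in s, h x * Real.log (h x) →
      h =ᵐ[volume.restrict s] g) := by
  have hnn' : 0 ≤ᵐ[volume.restrict s] h := by
    filter_upwards [ae_restrict_mem hs] with x hx using hnn x hx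
  rcases hg.form with h0 | ⟨α, β, hαβ⟩
  · have ha : a = 0 := by rw [← hg.mass]; simp [h0]
    have hz : h =ᵐ[volume.restrict s] 0 := by
      rw [← integral_eq_zero_iff_of_nonneg_ae hnn' hint, hmass, ha]
    have e1 : ∫ x in s, h x * Real.log (h x) = 0 := by
      rw [integral_eq_zero_of_ae]
      filter_upwards [hz] with x hx
      simp [hx]
    refine ⟨by rw [e1]; simp [h0], fun _ => ?_⟩
    filter_upwards [hz] with x hx
    simp [hx, h0]
  -- `D` is the pointwise divergence of `h` from `g`. As `log g` is affine, its integral against `h`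
  -- depends only on the prescribed moments, so `∫ D` is exactly the entropy gap.
  · set D : ℝ → ℝ := fun x => h x * Real.log (h x) - (α * h x + β * (x * h x)) - h x + g x with hD
    have i1 : IntegrableOn (fun x => α * h x + β * (x * h x)) s :=
      (hint.const_mul α).add (hxint.const_mul β)
    have hDint : IntegrableOn D s := ((hlog.sub i1).sub hint).add hg.integrableOn
    have hDnn : 0 ≤ᵐ[volume.restrict s] D := by
      filter_upwards [ae_restrict_mem hs] with x hx
      have := (mul_log_ge (hnn x hx) (hαβ x)).1
      have e : D x = h x * Real.log (h x) - (α + β * x) * h x - h x + g x := by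
        simp only [hD]; ring
      rw [Pi.zero_apply, e]
      exact this
    have eD : ∫ x in s, D x =
        (∫ x in s, h x * Real.log (h x)) - (α * a + β * (a * b)) - a + a := by
      have e1 : ∫ x in s, (α * h x + β * (x * h x)) = α * a + β * (a * b) := by
        rw [integral_add (hint.const_mul α) (hxint.const_mul β), integral_const_mul,
          integral_const_mul, hmass, hmean]
      have s1 : ∫ x in s, D x = (∫ x in s, (h x * Real.log (h x) - (α * h x + β * (x * h x)) - h x))
          + ∫ x in s, g x := integral_add ((hlog.sub i1).sub hint) hg.integrableOn
      have s2 : ∫ x in s, (h x * Real.log (h x) - (α * h x + β * (x * h x)) - h x) =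
          (∫ x in s, (h x * Real.log (h x) - (α * h x + β * (x * h x)))) - ∫ x in s, h x :=
        integral_sub (hlog.sub i1) hint
      rw [s1, s2, integral_sub hlog i1, e1, hmass, hg.mass]
    have eG : ∫ x in s, g x * Real.log (g x) = α * a + β * (a * b) := by
      have e : (fun x => g x * Real.log (g x)) = fun x => α * g x + β * (x * g x) := by
        ext x; rw [hαβ, Real.log_exp]; ring
      rw [e, integral_add (hg.integrableOn.const_mul α) (hg.integrableOn_mul.const_mul β),
        integral_const_mul, integral_const_mul, hg.mass, hg.moment]
    have hDi : 0 ≤ ∫ x in s, D x := integral_nonneg_of_ae hDnn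
    rw [eD] at hDi
    refine ⟨by rw [eG]; linarith, fun heq => ?_⟩
    have hz : D =ᵐ[volume.restrict s] 0 := by
      rw [← integral_eq_zero_iff_of_nonneg_ae hDnn hDint, eD, ← heq, eG]; ring
    filter_upwards [hz, ae_restrict_mem hs] with x hx hxs
    apply (mul_log_ge (hnn x hxs) (hαβ x)).2
    simp only [hD, Pi.zero_apply] at hx
    linarith

end IsExpPiece

/-! ### Gluing the pieces -/

/-- The function equal to `G k` on the `k`-th bin and to `0` below the lowest threshold. -/
def glue (K : ℕ) (t : ℕ → ℝ) (G : ℕ → ℝ → ℝ) (x : ℝ) : ℝ :=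
  ∑ k ∈ Finset.Icc 1 K, (bin t k).indicator (G k) x

lemma glue_of_mem (ht : StrictAntiOn t (Set.Icc 1 K)) (G : ℕ → ℝ → ℝ) {k : ℕ}
    (hk : k ∈ Set.Icc 1 K) {x : ℝ} (hx : x ∈ bin t k) : glue K t G x = G k x := by
  unfold glue
  rw [Finset.sum_eq_single k, Set.indicator_of_mem hx]
  · intro j hj hjk
    exact Set.indicator_of_notMem
      (fun hxj => hjk (eq_of_mem_bin ht (by simpa using hj) hk hxj hx)) _
  · intro h
    exact absurd (by simpa using hk) h

lemma glue_of_lt (ht : StrictAntiOn t (Set.Icc 1 K)) (G : ℕ → ℝ → ℝ) {x : ℝ} (hx : x < t K) :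
    glue K t G x = 0 := by
  apply Finset.sum_eq_zero
  intro k hk
  apply Set.indicator_of_notMem
  intro h
  have := bin_subset_Ici ht (by simpa using hk) h
  rw [Set.mem_Ici] at this
  linarith

lemma IsMEDensity.eq_of_ae_eq (hK : 1 ≤ K) (ht : StrictAntiOn t (Set.Icc 1 K)) {g₁ g₂ : ℝ → ℝ}
    (h₁ : IsMEDensity K t q y g₁) (h₂ : IsMEDensity K t q y g₂)
    (hae : g₁ =ᵐ[volume.restrict (Set.Ici (t K))] g₂) : g₁ = g₂ := by
  ext x
  rcases lt_or_ge x (t K) with hx | hx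
  · rw [h₁.zero_below x hx, h₂.zero_below x hx]
  · obtain ⟨k, hk, hxk⟩ := exists_mem_bin hK hx
    exact Measure.eqOn_of_ae_eq (ae_restrict_of_ae_restrict_of_subset (bin_subset_Ici ht hk) hae)
      (h₁.continuousOn k hk) (h₂.continuousOn k hk) (bin_subset_closure_interior ht hk) hxk

section Glue

variable {G : ℕ → ℝ → ℝ}

lemma isFeasible_glue (hK : 1 ≤ K) (ht : StrictAntiOn t (Set.Icc 1 K))
    (hG : ∀ k ∈ Set.Icc 1 K, IsExpPiece (bin t k) (q k) (y k) (G k)) :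
    IsFeasible K t q y (glue K t G) where
  nonneg x hx := by
    obtain ⟨k, hk, hxk⟩ := exists_mem_bin hK hx
    rw [glue_of_mem ht G hk hxk]
    exact (hG k hk).nonneg x
  integrable := integrableOn_Ici_of_bin hK ht fun k hk =>
    (hG k hk).integrableOn.congr_fun (fun _ hx => (glue_of_mem ht G hk hx).symm)
      (measurableSet_bin t k)
  prob k hk := by
    rw [← (hG k hk).mass]
    exact setIntegral_congr_fun (measurableSet_bin t k) fun _ hx => glue_of_mem ht G hk hx
  mean_integrable k hk := (hG k hk).integrableOn_mul.congr_fun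
    (fun x hx => by rw [glue_of_mem ht G hk hx]) (measurableSet_bin t k)
  mean k hk := by
    rw [← (hG k hk).moment]
    exact setIntegral_congr_fun (measurableSet_bin t k) fun x hx => by
      simp only [glue_of_mem ht G hk hx]

lemma integrableOn_glue_mul_log (ht : StrictAntiOn t (Set.Icc 1 K))
    (hG : ∀ k ∈ Set.Icc 1 K, IsExpPiece (bin t k) (q k) (y k) (G k)) {k : ℕ}
    (hk : k ∈ Set.Icc 1 K) :
    IntegrableOn (fun x => glue K t G x * Real.log (glue K t G x)) (bin t k) :=
  (hG k hk).integrableOn_mul_log.congr_fun (fun x hx => by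
    simp only [glue_of_mem ht G hk hx]) (measurableSet_bin t k)

lemma entropy_glue_bin_le (ht : StrictAntiOn t (Set.Icc 1 K))
    (hG : ∀ k ∈ Set.Icc 1 K, IsExpPiece (bin t k) (q k) (y k) (G k)) {h : ℝ → ℝ}
    (hh : IsFeasible K t q y h)
    (hlog : IntegrableOn (fun x => h x * Real.log (h x)) (Set.Ici (t K))) {k : ℕ}
    (hk : k ∈ Set.Icc 1 K) :
    ∫ x in bin t k, glue K t G x * Real.log (glue K t G x) ≤
      ∫ x in bin t k, h x * Real.log (h x) ∧
    (∫ x in bin t k, glue K t G x * Real.log (glue K t G x) =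
      ∫ x in bin t k, h x * Real.log (h x) → h =ᵐ[volume.restrict (bin t k)] glue K t G) := by
  have hsub := bin_subset_Ici ht hk
  have := (hG k hk).entropy_le (measurableSet_bin t k) (fun x hx => hh.nonneg x (hsub hx))
    (hh.integrable.mono_set hsub) (hh.prob k hk) (hh.mean_integrable k hk) (hh.mean k hk)
    (hlog.mono_set hsub)
  rw [setIntegral_congr_fun (g := fun x => G k x * Real.log (G k x)) (measurableSet_bin t k)
    (fun x hx => by simp only [glue_of_mem ht G hk hx])]
  refine ⟨this.1, fun heq => (this.2 heq).trans ?_⟩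
  filter_upwards [ae_restrict_mem (measurableSet_bin t k)] with x hx
  exact (glue_of_mem ht G hk hx).symm

lemma isMEDensity_glue (hK : 1 ≤ K) (ht : StrictAntiOn t (Set.Icc 1 K))
    (hG : ∀ k ∈ Set.Icc 1 K, IsExpPiece (bin t k) (q k) (y k) (G k)) :
    IsMEDensity K t q y (glue K t G) := by
  have hfin := integrableOn_Ici_of_bin hK ht fun k hk => integrableOn_glue_mul_log ht hG hk
  refine ⟨⟨isFeasible_glue hK ht hG, hfin, fun h hh hlog => ?_⟩, fun k hk => ?_,
    fun x hx => glue_of_lt ht G hx⟩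
  · rw [integral_Ici_eq_sum_bin hK ht hfin, integral_Ici_eq_sum_bin hK ht hlog]
    exact Finset.sum_le_sum fun k hk =>
      (entropy_glue_bin_le ht hG hh hlog (by simpa using hk)).1
  · exact (hG k hk).continuous.continuousOn.congr fun x hx => glue_of_mem ht G hk hx

/-- The two total entropies coincide and the comparison holds on each bin, so there is equality on
every bin and binwise uniqueness applies. -/
lemma IsMESolution.ae_eq_glue (hK : 1 ≤ K) (ht : StrictAntiOn t (Set.Icc 1 K))
    (hG : ∀ k ∈ Set.Icc 1 K, IsExpPiece (bin t k) (q k) (y k) (G k)) {h : ℝ → ℝ}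
    (hh : IsMESolution K t q y h) : h =ᵐ[volume.restrict (Set.Ici (t K))] glue K t G := by
  have hg := (isMEDensity_glue hK ht hG).solution
  have heq := le_antisymm (hg.minimal h hh.feasible hh.finite) (hh.minimal _ hg.feasible hg.finite)
  rw [integral_Ici_eq_sum_bin hK ht hg.finite, integral_Ici_eq_sum_bin hK ht hh.finite,
    Finset.sum_eq_sum_iff_of_le fun k hk =>
      (entropy_glue_bin_le ht hG hh.feasible hh.finite (by simpa using hk)).1] at heq
  rw [← biUnion_bin hK ht, Filter.EventuallyEq, ae_restrict_biUnion_finset_iff]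
  intro k hk
  exact (entropy_glue_bin_le ht hG hh.feasible hh.finite (by simpa using hk)).2 (heq k hk)

lemma meDensity_eq_glue (hK : 1 ≤ K) (ht : StrictAntiOn t (Set.Icc 1 K))
    (hG : ∀ k ∈ Set.Icc 1 K, IsExpPiece (bin t k) (q k) (y k) (G k)) :
    meDensity K t q y = glue K t G := by
  have hg := isMEDensity_glue hK ht hG
  have hex : ∃ g : ℝ → ℝ, IsMEDensity K t q y g := ⟨_, hg⟩
  rw [meDensity, dif_pos hex]
  exact hex.choose_spec.eq_of_ae_eq hK ht hg (hex.choose_spec.solution.ae_eq_glue hK ht hG)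

lemma exists_glue_le (hK : 1 ≤ K) (ht : StrictAntiOn t (Set.Icc 1 K))
    (hG : ∀ k ∈ Set.Icc 1 K, ∃ B, ∀ x ∈ bin t k, |G k x| ≤ B) :
    ∃ B, ∀ x, |glue K t G x| ≤ B := by
  choose! B hB using hG
  refine ⟨∑ k ∈ Finset.Icc 1 K, |B k|, fun x => ?_⟩
  rcases lt_or_ge x (t K) with hx | hx
  · rw [glue_of_lt ht G hx, abs_zero]
    exact Finset.sum_nonneg fun _ _ => abs_nonneg _
  · obtain ⟨k, hk, hxk⟩ := exists_mem_bin hK hx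
    rw [glue_of_mem ht G hk hxk]
    exact ((hB k hk x hxk).trans (le_abs_self _)).trans
      (Finset.single_le_sum (f := fun k => |B k|) (fun _ _ => abs_nonneg _) (by simpa using hk))

end Glue

end Bins

/-! ### Existence of the pieces -/

lemma isExpPiece_zero (s : Set ℝ) (b : ℝ) : IsExpPiece s 0 b (fun _ => 0) where
  continuous := continuous_const
  nonneg _ := le_rfl
  bounded := ⟨0, fun _ _ => le_rfl⟩
  integrableOn := by simp
  mass := by simp
  integrableOn_mul := by simp
  moment := by simp
  form := Or.inl fun _ => rfl

/-- Maximum entropy density on `[a, a + h)` with mass `m₀` and first moment `m₁` about `a`. -/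
def binDensity (a h m₀ m₁ x : ℝ) : ℝ :=
  m₀ / h * tiltDensity (m₁ / h ^ 2 / (m₀ / h)) ((x - a) / h)

/-- Maximum entropy density on `[a, ∞)` with mass `m₀` and first moment `m₁` about `a`. -/
def topDensity (a m₀ m₁ x : ℝ) : ℝ := m₀ * (m₀ / m₁ * Real.exp (-(m₀ / m₁ * (x - a))))

lemma continuous_binDensity (a h m₀ m₁ : ℝ) : Continuous (binDensity a h m₀ m₁) := by
  have := continuous_tiltDensity (m₁ / h ^ 2 / (m₀ / h))
  unfold binDensity; fun_prop

lemma integral_Ico_comp_div {a h : ℝ} (hh : 0 < h) (F : ℝ → ℝ) :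
    ∫ x in Set.Ico a (a + h), F ((x - a) / h) = h * ∫ u in (0 : ℝ)..1, F u := by
  rw [integral_Ico_eq_integral_Ioc, ← intervalIntegral.integral_of_le (by linarith),
    intervalIntegral.integral_comp_sub_right (fun x => F (x / h)) a,
    intervalIntegral.integral_comp_div _ hh.ne', sub_self, zero_div, add_sub_cancel_left,
    div_self hh.ne', smul_eq_mul]

/-- The bounds on `m₁` say that the bin mean is strictly interior, which is what makes the tilt
equation solvable. -/
lemma isExpPiece_binDensity {a h m₀ m₁ b : ℝ} (hh : 0 < h) (h0 : 0 < m₁) (h1 : m₁ < h * m₀)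
    (hb : m₀ * b = m₁ + a * m₀) :
    IsExpPiece (Set.Ico a (a + h)) m₀ b (binDensity a h m₀ m₁) := by
  have hm₀ : 0 < m₀ := pos_of_mul_pos_right (h0.trans h1) hh.le
  have hc := continuous_binDensity a h m₀ m₁
  set m := m₁ / h ^ 2 / (m₀ / h) with hm
  have hmeq : m * (h * m₀) = m₁ := by rw [hm]; field_simp
  have hm0 : 0 < m := by positivity
  have hm1 : m < 1 := by
    have hp : 0 < h * m₀ := by positivity
    by_contra hcon
    nlinarith
  have hmass : ∫ x in Set.Ico a (a + h), binDensity a h m₀ m₁ x = m₀ := by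
    unfold binDensity
    rw [integral_const_mul, ← hm, integral_Ico_comp_div hh (tiltDensity m), integral_tiltDensity]
    field_simp
  have hint : ∀ φ : ℝ → ℝ, Continuous φ → IntegrableOn φ (Set.Ico a (a + h)) := fun φ hφ =>
    (hφ.integrableOn_Icc (a := a) (b := a + h)).mono_set Set.Ico_subset_Icc_self
  refine ⟨hc, fun x => mul_nonneg (by positivity) (tiltDensity_pos _ _).le, ?_, hint _ hc, hmass,
    hint _ (by fun_prop), ?_, Or.inr ?_⟩
  · obtain ⟨B, hB⟩ := (isCompact_Icc (a := a) (b := a + h)).bddAbove_image hc.continuousOn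
    exact ⟨B, fun x hx => hB ⟨x, Set.Ico_subset_Icc_self hx, rfl⟩⟩
  · have h2 : ∫ x in Set.Ico a (a + h), (x - a) / h * tiltDensity m ((x - a) / h) = h * m := by
      rw [integral_Ico_comp_div hh (fun u => u * tiltDensity m u), integral_mul_tiltDensity hm0 hm1]
    have e : ∀ x, x * binDensity a h m₀ m₁ x =
        m₀ * ((x - a) / h * tiltDensity m ((x - a) / h)) + a * binDensity a h m₀ m₁ x := by
      intro x
      unfold binDensity
      rw [← hm]
      field_simp
      ring
    simp_rw [e]
    have hct := continuous_tiltDensity m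
    rw [integral_add (hint _ (by fun_prop)) (hint _ (by fun_prop)), integral_const_mul,
      integral_const_mul, h2, hmass, hb, ← hmeq]
    ring
  · set β := tiltParam m with hβ
    have hp : 0 < m₀ / h / tiltNorm β := div_pos (div_pos hm₀ hh) (tiltNorm_pos β)
    refine ⟨Real.log (m₀ / h / tiltNorm β) - β * a / h, β / h, fun x => ?_⟩
    rw [show Real.log (m₀ / h / tiltNorm β) - β * a / h + β / h * x =
      Real.log (m₀ / h / tiltNorm β) + β * ((x - a) / h) by field_simp; ring, Real.exp_add,
      Real.exp_log hp]
    unfold binDensity tiltDensity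
    rw [← hm, ← hβ]
    ring

/-- An exponential law shifted to `a` with rate `m₀ / m₁` has mean excess `m₁ / m₀`. Mass and moment
come from explicit antiderivatives vanishing at infinity. -/
lemma isExpPiece_topDensity {a m₀ m₁ b : ℝ} (hm₀ : 0 < m₀) (hm₁ : 0 < m₁)
    (hb : m₀ * b = m₁ + a * m₀) :
    IsExpPiece (Set.Ici a) m₀ b (topDensity a m₀ m₁) := by
  set r := m₀ / m₁ with hr
  have hr0 : 0 < r := div_pos hm₀ hm₁
  have hlim : Tendsto (fun x => r * (x - a)) atTop atTop :=
    (tendsto_atTop_add_const_right _ (-a) tendsto_id).const_mul_atTop hr0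
  have hl0 : Tendsto (fun x => Real.exp (-(r * (x - a)))) atTop (𝓝 0) :=
    Real.tendsto_exp_neg_atTop_nhds_zero.comp hlim
  have hl1 : Tendsto (fun x => r * (x - a) * Real.exp (-(r * (x - a)))) atTop (𝓝 0) := by
    have := (Real.tendsto_pow_mul_exp_neg_atTop_nhds_zero 1).comp hlim
    simpa [Function.comp_def] using this
  have hexp : ∀ x, HasDerivAt (fun x => Real.exp (-(r * (x - a))))
      (Real.exp (-(r * (x - a))) * (-(r * 1))) x := fun x =>
    ((((hasDerivAt_id x).sub_const a).const_mul r).fun_neg).exp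
  have hF0 : ∀ x, HasDerivAt (fun x => -Real.exp (-(r * (x - a))))
      (r * Real.exp (-(r * (x - a)))) x := fun x => by
    have := (hexp x).fun_neg
    rwa [show -(Real.exp (-(r * (x - a))) * (-(r * 1))) = r * Real.exp (-(r * (x - a))) by ring]
      at this
  have hF1 : ∀ x, HasDerivAt (fun x => -(r * (x - a) * Real.exp (-(r * (x - a)))) / r -
      Real.exp (-(r * (x - a))) / r)
      ((x - a) * (r * Real.exp (-(r * (x - a))))) x := fun x => by
    have h1 : HasDerivAt (fun x => r * (x - a)) (r * 1) x :=
      ((hasDerivAt_id x).sub_const a).const_mul r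
    refine ((((h1.fun_mul (hexp x)).fun_neg).div_const r).fun_sub
      ((hexp x).div_const r)).congr_deriv ?_
    field_simp
    ring
  have hl0' : Tendsto (fun x => -Real.exp (-(r * (x - a)))) atTop (𝓝 0) := by
    simpa using hl0.neg
  have hl1' : Tendsto (fun x => -(r * (x - a) * Real.exp (-(r * (x - a)))) / r -
      Real.exp (-(r * (x - a))) / r) atTop (𝓝 0) := by
    simpa using (hl1.neg.div_const r).sub (hl0.div_const r)
  have hnn1 : ∀ x ∈ Set.Ioi a, 0 ≤ (x - a) * (r * Real.exp (-(r * (x - a)))) := fun x hx =>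
    mul_nonneg (sub_nonneg.2 (le_of_lt hx)) (mul_nonneg hr0.le (Real.exp_pos _).le)
  have i0 : IntegrableOn (fun x => r * Real.exp (-(r * (x - a)))) (Set.Ici a) :=
    integrableOn_Ici_iff_integrableOn_Ioi (by simp) |>.2 <| integrableOn_Ioi_deriv_of_nonneg'
      (fun x _ => hF0 x) (fun x _ => mul_nonneg hr0.le (Real.exp_pos _).le) hl0'
  have i1 : IntegrableOn (fun x => (x - a) * (r * Real.exp (-(r * (x - a))))) (Set.Ici a) :=
    integrableOn_Ici_iff_integrableOn_Ioi (by simp) |>.2 <| integrableOn_Ioi_deriv_of_nonneg'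
      (fun x _ => hF1 x) hnn1 hl1'
  have v0 : ∫ x in Set.Ici a, r * Real.exp (-(r * (x - a))) = 1 := by
    rw [integral_Ici_eq_integral_Ioi, integral_Ioi_of_hasDerivAt_of_nonneg'
      (fun x _ => hF0 x) (fun x _ => mul_nonneg hr0.le (Real.exp_pos _).le) hl0']
    simp
  have v1 : ∫ x in Set.Ici a, (x - a) * (r * Real.exp (-(r * (x - a)))) = 1 / r := by
    rw [integral_Ici_eq_integral_Ioi, integral_Ioi_of_hasDerivAt_of_nonneg'
      (fun x _ => hF1 x) hnn1 hl1']
    simp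
  have hf : topDensity a m₀ m₁ = fun x => m₀ * (r * Real.exp (-(r * (x - a)))) := rfl
  have e : (fun x => x * topDensity a m₀ m₁ x) = fun x =>
      m₀ * ((x - a) * (r * Real.exp (-(r * (x - a))))) +
        a * m₀ * (r * Real.exp (-(r * (x - a)))) := by
    ext x; rw [hf]; ring
  refine ⟨by rw [hf]; fun_prop, fun x => ?_, ⟨m₀ * r, fun x hx => ?_⟩, ?_, ?_, ?_, ?_, Or.inr ?_⟩
  · rw [hf]; positivity
  · rw [hf]
    have : Real.exp (-(r * (x - a))) ≤ 1 := Real.exp_le_one_iff.2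
      (neg_nonpos.2 (mul_nonneg hr0.le (sub_nonneg.2 hx)))
    have h2 : m₀ * r * Real.exp (-(r * (x - a))) ≤ m₀ * r * 1 :=
      mul_le_mul_of_nonneg_left this (by positivity)
    simpa [mul_assoc] using h2
  · rw [hf]; exact i0.const_mul m₀
  · rw [hf, integral_const_mul, v0, mul_one]
  · rw [e]; exact (i1.const_mul m₀).add (i0.const_mul _)
  · rw [e, integral_add (i1.const_mul m₀) (i0.const_mul _), integral_const_mul,
      integral_const_mul, v0, v1, hb, hr]
    field_simp
  · have hp : 0 < m₀ * r := by positivity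
    refine ⟨Real.log (m₀ * r) + r * a, -r, fun x => ?_⟩
    rw [show Real.log (m₀ * r) + r * a + -r * x = Real.log (m₀ * r) + -(r * (x - a)) by ring,
      Real.exp_add, Real.exp_log hp, hf]
    ring

/-! ### Tabulated data as empirical bin moments -/

section Empirical

variable {n : ℕ} {y : Fin n → ℝ} {t : ℕ → ℝ} {K k : ℕ}

/-- Fraction of the sample in the `k`-th bin. -/
def empMass (y : Fin n → ℝ) (t : ℕ → ℝ) (k : ℕ) : ℝ :=
  (∑ i, (bin t k).indicator (fun _ => (1 : ℝ)) (y i)) / n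

/-- Empirical first moment of the `k`-th bin about its lower threshold. -/
def empMoment (y : Fin n → ℝ) (t : ℕ → ℝ) (k : ℕ) : ℝ :=
  (∑ i, (bin t k).indicator (fun x => x - t k) (y i)) / n

lemma antitone_orderStat (y : Fin n → ℝ) : Antitone (orderStat y) := by
  intro i j hij
  have := Tuple.monotone_sort (fun j => -y j) hij
  simp only [Function.comp_apply] at this
  unfold orderStat
  linarith

lemma sum_comp_orderStat (y : Fin n → ℝ) (φ : ℝ → ℝ) :
    ∑ i, φ (orderStat y i) = ∑ i, φ (y i) :=
  Equiv.sum_comp (Tuple.sort fun j => -y j) (fun i => φ (y i))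

lemma cast_topCount (y : Fin n → ℝ) (t : ℕ → ℝ) (hk : k ≠ 0) :
    (topCount y t k : ℝ) = ∑ i, if t k ≤ y i then (1 : ℝ) else 0 := by
  rw [topCount, if_neg hk, Finset.card_filter, Nat.cast_sum,
    ← sum_comp_orderStat y (fun x => if t k ≤ x then (1 : ℝ) else 0)]
  simp

/-- In a descending list, an index is below the number of values `≥ t k` exactly when its own value
is `≥ t k`. -/
lemma partialSum_topCount (y : Fin n → ℝ) (t : ℕ → ℝ) (hk : k ≠ 0) :
    partialSum y (topCount y t k) = ∑ i, if t k ≤ y i then y i else 0 := by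
  rw [← sum_comp_orderStat y (fun x => if t k ≤ x then x else 0), partialSum, topCount, if_neg hk]
  refine Finset.sum_congr rfl fun i _ => ?_
  simp only [Tuple.lt_card_ge_iff_apply_ge_of_antitone (antitone_orderStat y)]

lemma topCount_zero (y : Fin n → ℝ) (t : ℕ → ℝ) : topCount y t 0 = 0 := by simp [topCount]

lemma partialSum_zero (y : Fin n → ℝ) : partialSum y 0 = 0 := by simp [partialSum]

lemma topCount_sub (ht : StrictAntiOn t (Set.Icc 1 K)) (hk : k ∈ Set.Icc 1 K) :
    (topCount y t k : ℝ) - topCount y t (k - 1) =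
      ∑ i, (bin t k).indicator (fun _ => (1 : ℝ)) (y i) := by
  rcases eq_or_ne k 1 with rfl | h1
  · rw [cast_topCount y t one_ne_zero, Nat.sub_self, topCount_zero, bin_one]
    simp [Set.indicator_apply]
  · have h2 : 2 ≤ k := by have := hk.1; omega
    have hlt : t k < t (k - 1) := ht ⟨by omega, by have := hk.2; omega⟩ hk (by omega)
    rw [cast_topCount y t (by omega), cast_topCount y t (by omega), bin_of_two_le t h2,
      ← Finset.sum_sub_distrib]
    refine Finset.sum_congr rfl fun i _ => ?_
    simp only [Set.indicator_apply, Set.mem_Ico]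
    split_ifs <;> grind

lemma partialSum_sub (ht : StrictAntiOn t (Set.Icc 1 K)) (hk : k ∈ Set.Icc 1 K) :
    partialSum y (topCount y t k) - partialSum y (topCount y t (k - 1)) =
      ∑ i, (bin t k).indicator (fun x => x) (y i) := by
  rcases eq_or_ne k 1 with rfl | h1
  · rw [partialSum_topCount y t one_ne_zero, Nat.sub_self, topCount_zero, bin_one, partialSum_zero]
    simp [Set.indicator_apply]
  · have h2 : 2 ≤ k := by have := hk.1; omega
    have hlt : t k < t (k - 1) := ht ⟨by omega, by have := hk.2; omega⟩ hk (by omega)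
    rw [partialSum_topCount y t (by omega), partialSum_topCount y t (by omega), bin_of_two_le t h2,
      ← Finset.sum_sub_distrib]
    refine Finset.sum_congr rfl fun i _ => ?_
    simp only [Set.indicator_apply, Set.mem_Ico]
    split_ifs <;> grind

lemma qHat_eq (ht : StrictAntiOn t (Set.Icc 1 K)) (hk : k ∈ Set.Icc 1 K) :
    qHat y t k = empMass y t k := by
  rw [qHat, topCount_sub ht hk, empMass]

lemma sum_indicator_eq_zero_iff {s : Set ℝ} :
    ∑ i, s.indicator (fun _ => (1 : ℝ)) (y i) = 0 ↔ ∀ i, y i ∉ s := by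
  rw [Finset.sum_eq_zero_iff_of_nonneg fun i _ => Set.indicator_nonneg (fun _ _ => zero_le_one) _]
  simp

lemma empMass_nonneg : 0 ≤ empMass y t k :=
  div_nonneg (Finset.sum_nonneg fun _ _ => Set.indicator_nonneg (fun _ _ => zero_le_one) _)
    (Nat.cast_nonneg n)

lemma empMass_mul_yHat (ht : StrictAntiOn t (Set.Icc 1 K)) (hk : k ∈ Set.Icc 1 K) :
    empMass y t k * yHat y t k = empMoment y t k + t k * empMass y t k := by
  have e : ∑ i, (bin t k).indicator (fun x => x - t k) (y i) =
      ∑ i, (bin t k).indicator (fun x => x) (y i) -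
        t k * ∑ i, (bin t k).indicator (fun _ => (1 : ℝ)) (y i) := by
    rw [Finset.mul_sum, ← Finset.sum_sub_distrib]
    refine Finset.sum_congr rfl fun i _ => ?_
    by_cases h : y i ∈ bin t k <;> simp [h]
  rw [yHat, topCount_sub ht hk, partialSum_sub ht hk, empMoment, e, empMass]
  -- In an empty bin `yHat` is `0 / 0 = 0`, and both sides vanish.
  by_cases h : ∑ i, (bin t k).indicator (fun _ => (1 : ℝ)) (y i) = 0
  · rw [h]
    have h' := sum_indicator_eq_zero_iff.1 h
    simp [h']
  · field_simp
    ring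

/-- The maximum entropy density on the `k`-th bin with mass `m₀ k` and first moment `m₁ k` about
the lower threshold. -/
def piece (t m₀ m₁ : ℕ → ℝ) (k : ℕ) : ℝ → ℝ :=
  if k = 1 then topDensity (t 1) (m₀ 1) (m₁ 1)
  else binDensity (t k) (t (k - 1) - t k) (m₀ k) (m₁ k)

/-- One observation off the lower threshold suffices; this is where ties must be excluded. -/
lemma empMoment_pos (hn : 1 ≤ n) (hne : ∀ i, y i ≠ t k) (h0 : empMass y t k ≠ 0) :
    0 < empMoment y t k := by
  have hn' : (0 : ℝ) < n := by exact_mod_cast hn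
  have h1 : ¬ ∀ i, y i ∉ bin t k := fun h => h0 (by
    rw [empMass, sum_indicator_eq_zero_iff.2 h, zero_div])
  push Not at h1
  obtain ⟨i, hi⟩ := h1
  refine div_pos (Finset.sum_pos' (fun j _ => Set.indicator_nonneg
    (fun x hx => sub_nonneg.2 (le_of_mem_bin hx)) _) ⟨i, Finset.mem_univ i, ?_⟩) hn'
  rw [Set.indicator_of_mem hi]
  exact sub_pos.2 (lt_of_le_of_ne (le_of_mem_bin hi) (hne i).symm)

/-- Strictness is free at the upper end, the bin being half-open. -/
lemma empMoment_lt (hn : 1 ≤ n) (hk : 2 ≤ k) (h0 : empMass y t k ≠ 0) :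
    empMoment y t k < (t (k - 1) - t k) * empMass y t k := by
  have hn' : (0 : ℝ) < n := by exact_mod_cast hn
  have h1 : ¬ ∀ i, y i ∉ bin t k := fun h => h0 (by
    rw [empMass, sum_indicator_eq_zero_iff.2 h, zero_div])
  push Not at h1
  obtain ⟨i, hi⟩ := h1
  rw [empMoment, empMass, ← mul_div_assoc, Finset.mul_sum]
  refine div_lt_div_of_pos_right (Finset.sum_lt_sum (fun j _ => ?_) ⟨i, Finset.mem_univ i, ?_⟩) hn'
  · by_cases hj : y j ∈ bin t k
    · rw [Set.indicator_of_mem hj, Set.indicator_of_mem hj]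
      have := lt_of_mem_bin (by omega) hj
      linarith
    · simp [hj]
  · rw [Set.indicator_of_mem hi, Set.indicator_of_mem hi]
    have := lt_of_mem_bin (by omega) hi
    linarith

lemma isExpPiece_piece (hn : 1 ≤ n) (ht : StrictAntiOn t (Set.Icc 1 K))
    (hk : k ∈ Set.Icc 1 K) (hne : ∀ i, y i ≠ t k) :
    IsExpPiece (bin t k) (qHat y t k) (yHat y t k) (piece t (empMass y t) (empMoment y t) k) := by
  rw [qHat_eq ht hk]
  have hb := empMass_mul_yHat (y := y) ht hk
  by_cases h0 : empMass y t k = 0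
  · have hz : piece t (empMass y t) (empMoment y t) k = fun _ => 0 := by
      unfold piece
      split_ifs with h
      · subst h; ext x; simp [topDensity, h0]
      · ext x; simp [binDensity, h0]
    rw [hz, h0]
    exact isExpPiece_zero _ _
  have hpos := empMoment_pos hn hne h0
  rcases eq_or_ne k 1 with rfl | h1
  · rw [piece, if_pos rfl, bin_one]
    exact isExpPiece_topDensity (empMass_nonneg.lt_of_ne' h0) hpos hb
  · have h2 : 2 ≤ k := by have := hk.1; omega
    have hlt : t k < t (k - 1) := ht ⟨by omega, by have := hk.2; omega⟩ hk (by omega)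
    rw [piece, if_neg h1, bin_of_two_le t h2]
    have := isExpPiece_binDensity (a := t k) (sub_pos.2 hlt) hpos (empMoment_lt hn h2 h0) hb
    rwa [add_sub_cancel] at this

lemma meEstimator_eq_glue (hn : 1 ≤ n) (hK : 1 ≤ K) (ht : StrictAntiOn t (Set.Icc 1 K))
    (hne : ∀ i, ∀ k ∈ Set.Icc 1 K, y i ≠ t k) :
    meEstimator K t y = glue K t (piece t (empMass y t) (empMoment y t)) :=
  meDensity_eq_glue hK ht fun k hk => isExpPiece_piece hn ht hk fun i => hne i k hk

lemma exists_abs_meEstimator_le (hn : 1 ≤ n) (hK : 1 ≤ K) (ht : StrictAntiOn t (Set.Icc 1 K))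
    (hne : ∀ i, ∀ k ∈ Set.Icc 1 K, y i ≠ t k) : ∃ B, ∀ x, |meEstimator K t y x| ≤ B := by
  rw [meEstimator_eq_glue hn hK ht hne]
  refine exists_glue_le hK ht fun k hk => ?_
  have h := isExpPiece_piece hn ht hk fun i => hne i k hk
  obtain ⟨B, hB⟩ := h.bounded
  exact ⟨B, fun x hx => by rw [abs_of_nonneg (h.nonneg x)]; exact hB x hx⟩

end Empirical

/-! ### Concentration of the empirical bin moments -/

/-- Probability of the `k`-th bin under the density `f`. -/
def popMass (f : ℝ → ℝ) (t : ℕ → ℝ) (k : ℕ) : ℝ := ∫ x in bin t k, f x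

/-- First moment of the `k`-th bin about its lower threshold under the density `f`. -/
def popMoment (f : ℝ → ℝ) (t : ℕ → ℝ) (k : ℕ) : ℝ := ∫ x in bin t k, (x - t k) * f x

section Probability

variable {Ω : Type*} [MeasurableSpace Ω] {P : Measure Ω} {f : ℝ → ℝ} {Y : ℕ → Ω → ℝ}

lemma integral_comp_of_law (hf : Measurable f) (hf0 : ∀ x, 0 ≤ f x) {X : Ω → ℝ}
    (hX : Measurable X)
    (hlaw : P.map X = volume.withDensity (fun x => ENNReal.ofReal (f x))) {φ : ℝ → ℝ}
    (hφ : Measurable φ) : ∫ ω, φ (X ω) ∂P = ∫ x, f x * φ x := by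
  rw [← integral_map hX.aemeasurable (by rw [hlaw]; exact hφ.aestronglyMeasurable), hlaw,
    integral_withDensity_eq_integral_toReal_smul (by fun_prop) (by simp)]
  simp [ENNReal.toReal_ofReal, hf0]

/-- Hoeffding's inequality with the deviation measured in units of the range `b - a`, so that the
bound does not depend on the bin width. -/
lemma measureReal_sum_ge_le [IsProbabilityMeasure P] {X : ℕ → Ω → ℝ}
    (hX : ∀ i, Measurable (X i)) (hind : iIndepFun X P) {a b m : ℝ} (hab : a < b)
    (hmem : ∀ i ω, X i ω ∈ Set.Icc a b) (hm : ∀ i, ∫ ω, X i ω ∂P = m) {n : ℕ} (hn : 1 ≤ n)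
    {s : ℝ} (hs : 0 ≤ s) :
    P.real {ω | n * ((b - a) * s) ≤ ∑ i ∈ Finset.range n, (X i ω - m)} ≤
      Real.exp (-2 * (n * s ^ 2)) := by
  have hn' : (0 : ℝ) < n := by exact_mod_cast hn
  have hba : 0 < b - a := sub_pos.2 hab
  have hsub : ∀ i < n, HasSubgaussianMGF (fun ω => X i ω - m) ((‖b - a‖₊ / 2) ^ 2) P := by
    intro i _
    have := hasSubgaussianMGF_of_mem_Icc (μ := P) (hX i).aemeasurable
      (Filter.Eventually.of_forall (hmem i))
    rwa [hm i] at this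
  have hind' : iIndepFun (fun i ω => X i ω - m) P :=
    hind.comp (fun _ x => x - m) (fun _ => by fun_prop)
  have h := HasSubgaussianMGF.measure_sum_range_ge_le_of_iIndepFun hind' hsub
    (ε := n * ((b - a) * s)) (by positivity)
  refine h.trans (le_of_eq ?_)
  congr 1
  push_cast
  rw [Real.norm_eq_abs, abs_of_pos hba]
  field_simp

/-- Two-sided Hoeffding inequality for the empirical mean of `φ`, where `0 ≤ φ ≤ c`. -/
lemma measureReal_abs_empirical_sub_gt_le [IsProbabilityMeasure P] (hf : Measurable f)
    (hf0 : ∀ x, 0 ≤ f x) (hY : ∀ i, Measurable (Y i)) (hind : iIndepFun Y P)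
    (hlaw : ∀ i, P.map (Y i) = volume.withDensity (fun x => ENNReal.ofReal (f x)))
    {φ : ℝ → ℝ} (hφ : Measurable φ) {c : ℝ} (hc : 0 < c) (hmem : ∀ x, φ x ∈ Set.Icc 0 c)
    {n : ℕ} (hn : 1 ≤ n) {s : ℝ} (hs : 0 ≤ s) :
    P.real {ω | c * s < |(∑ i : Fin n, φ (Y i ω)) / n - ∫ x, f x * φ x|} ≤
      2 * Real.exp (-2 * (n * s ^ 2)) := by
  have hn' : (0 : ℝ) < n := by exact_mod_cast hn
  set m := ∫ x, f x * φ x with hm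
  have hmean : ∀ i, ∫ ω, φ (Y i ω) ∂P = m := fun i =>
    integral_comp_of_law hf hf0 (hY i) (hlaw i) hφ
  have h1 := measureReal_sum_ge_le (P := P) (X := fun i ω => φ (Y i ω))
    (fun i => hφ.comp (hY i)) (hind.comp (fun _ => φ) (fun _ => hφ)) hc (fun i ω => hmem (Y i ω))
    hmean hn hs
  have h2 := measureReal_sum_ge_le (P := P) (X := fun i ω => -φ (Y i ω)) (a := -c) (b := 0)
    (m := -m) (fun i => (hφ.comp (hY i)).neg)
    (hind.comp (fun _ x => -φ x) (fun _ => hφ.neg)) (by linarith)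
    (fun i ω => by have := hmem (Y i ω); exact ⟨by linarith [this.2], by linarith [this.1]⟩)
    (fun i => by rw [integral_neg, hmean i]) hn hs
  have hsub : {ω | c * s < |(∑ i : Fin n, φ (Y i ω)) / n - m|} ⊆
      {ω | n * ((c - 0) * s) ≤ ∑ i ∈ Finset.range n, (φ (Y i ω) - m)} ∪
      {ω | n * ((0 - -c) * s) ≤ ∑ i ∈ Finset.range n, (-φ (Y i ω) - -m)} := by
    intro ω hω
    simp only [Set.mem_ofPred_eq] at hω
    have hsum : ∑ i : Fin n, φ (Y i ω) = ∑ i ∈ Finset.range n, φ (Y i ω) :=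
      Fin.sum_univ_eq_sum_range (fun i => φ (Y i ω)) n
    rw [hsum] at hω
    set S := ∑ i ∈ Finset.range n, φ (Y i ω) with hS
    have hdiv : S / n * n = S := div_mul_cancel₀ _ hn'.ne'
    rcases lt_abs.1 hω with h | h
    · left
      simp only [Set.mem_ofPred_eq, Finset.sum_sub_distrib, ← hS, Finset.sum_const,
        Finset.card_range, nsmul_eq_mul]
      nlinarith
    · right
      simp only [Set.mem_ofPred_eq, Finset.sum_sub_distrib, Finset.sum_neg_distrib, ← hS,
        Finset.sum_const, Finset.card_range, nsmul_eq_mul]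
      nlinarith
  calc P.real _ ≤ P.real _ := measureReal_mono hsub
    _ ≤ _ := measureReal_union_le _ _
    _ ≤ _ := by linarith

lemma summable_rpow_mul_exp_neg {r : ℝ} (hr : 0 < r) (W : ℝ) :
    Summable (fun n : ℕ => W * (n : ℝ) ^ r * Real.exp (-2 * (n : ℝ) ^ (2 * r))) := by
  have hlim : Tendsto (fun n : ℕ => (n : ℝ) ^ (2 * r)) atTop atTop :=
    (tendsto_rpow_atTop (by positivity)).comp tendsto_natCast_atTop_atTop
  -- The exponent `2 + r` leaves `n ^ (-2)` after multiplication by `n ^ r`.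
  have h1 : (fun n : ℕ => Real.exp (-2 * (n : ℝ) ^ (2 * r))) =O[atTop]
      fun n : ℕ => (n : ℝ) ^ (-(2 + r)) := by
    have h := ((isLittleO_exp_neg_mul_rpow_atTop (a := 2) (by norm_num)
      (-(2 + r) / (2 * r))).comp_tendsto hlim).isBigO
    refine h.congr_right fun n => ?_
    simp only [Function.comp_apply]
    rw [← Real.rpow_mul (Nat.cast_nonneg n)]
    congr 1
    field_simp
  have h2 : (fun n : ℕ => W * (n : ℝ) ^ r * Real.exp (-2 * (n : ℝ) ^ (2 * r))) =O[atTop]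
      fun n : ℕ => (n : ℝ) ^ (-2 : ℝ) := by
    have h3 : (fun n : ℕ => W * (n : ℝ) ^ r) =O[atTop] fun n : ℕ => (n : ℝ) ^ r :=
      (isBigO_refl _ _).const_mul_left W
    refine (h3.mul h1).trans_eventuallyEq ?_
    filter_upwards [eventually_ge_atTop 1] with n hn
    rw [← Real.rpow_add (by exact_mod_cast hn)]
    congr 1
    ring
  exact summable_of_isBigO_nat (Real.summable_nat_rpow.2 (by norm_num)) h2

lemma ae_forall_ne_of_law (hY : ∀ i, Measurable (Y i))
    (hlaw : ∀ i, P.map (Y i) = volume.withDensity (fun x => ENNReal.ofReal (f x)))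
    (t : ℕ → ℕ → ℝ) : ∀ᵐ ω ∂P, ∀ i n k, Y i ω ≠ t n k := by
  simp_rw [ae_all_iff]
  intro i n k
  have h : P.map (Y i) {t n k} = 0 := by
    rw [hlaw i]
    exact withDensity_absolutelyContinuous _ _ (measure_singleton _)
  rw [Measure.map_apply (hY i) (measurableSet_singleton _)] at h
  exact measure_eq_zero_iff_ae_notMem.1 h

/-- Volume count: the bins are disjoint, each has length at least `w`, and all lie in `[A - v, B +
v]`. -/
lemma card_bins_mul_le {t : ℕ → ℝ} {K : ℕ} (ht : StrictAntiOn t (Set.Icc 1 K)) {C : Set ℝ}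
    {A B w v : ℝ} (hC : C ⊆ Set.Icc A B)
    (hw : ∀ k ∈ Set.Icc 2 K, w ≤ t (k - 1) - t k ∧ t (k - 1) - t k ≤ v) {S : Finset ℕ}
    (hS : ∀ k ∈ S, k ∈ Set.Icc 2 K ∧ (bin t k ∩ C).Nonempty) :
    S.card * w ≤ max (B - A + 2 * v) 0 := by
  have hsub : ⋃ k ∈ S, bin t k ⊆ Set.Icc (A - v) (B + v) := by
    intro x hx
    simp only [Set.mem_iUnion, exists_prop] at hx
    obtain ⟨k, hk, hx⟩ := hx
    obtain ⟨hkK, z, hz, hzC⟩ := hS k hk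
    have h2 : k ≠ 1 := by have := hkK.1; omega
    have := hw k hkK
    have := hC hzC
    constructor <;>
    linarith [le_of_mem_bin hx, le_of_mem_bin hz, lt_of_mem_bin h2 hx, lt_of_mem_bin h2 hz,
      this.1, this.2]
  have hK : ∀ k ∈ S, k ∈ Set.Icc 1 K := fun k hk =>
    ⟨by have := (hS k hk).1.1; omega, (hS k hk).1.2⟩
  have hdisj : (↑S : Set ℕ).PairwiseDisjoint (bin t) := by
    intro j hj k hk hjk
    rw [Function.onFun, Set.disjoint_left]
    exact fun x hxj hxk => hjk (eq_of_mem_bin ht (hK j hj) (hK k hk) hxj hxk)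
  have h1 := measure_mono (μ := volume) hsub
  rw [measure_biUnion_finset hdisj (fun k _ => measurableSet_bin t k), Real.volume_Icc] at h1
  have h2 : ∑ k ∈ S, ENNReal.ofReal w ≤ ∑ k ∈ S, volume (bin t k) := by
    refine Finset.sum_le_sum fun k hk => ?_
    rw [bin_of_two_le t (hS k hk).1.1, Real.volume_Ico]
    exact ENNReal.ofReal_le_ofReal (hw k (hS k hk).1).1
  have h3 := h2.trans h1
  rw [Finset.sum_const, ← ENNReal.ofReal_nsmul, nsmul_eq_mul, ENNReal.ofReal_le_ofReal_iff'] at h3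
  rcases h3 with h | h
  · exact le_max_of_le_left (by linarith)
  · exact le_max_of_le_right h

lemma integral_mul_indicator (f φ : ℝ → ℝ) {s : Set ℝ} (hs : MeasurableSet s) :
    ∫ x, f x * s.indicator φ x = ∫ x in s, φ x * f x := by
  rw [← integral_indicator hs]
  congr 1
  ext x
  by_cases h : x ∈ s <;> simp [h, mul_comm]

/-- Probability that the empirical moments of one bin deviate from the population moments. -/
lemma measureReal_bin_deviation_le [IsProbabilityMeasure P] (hf : Measurable f)
    (hf0 : ∀ x, 0 ≤ f x) (hY : ∀ i, Measurable (Y i)) (hind : iIndepFun Y P)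
    (hlaw : ∀ i, P.map (Y i) = volume.withDensity (fun x => ENNReal.ofReal (f x)))
    {t : ℕ → ℝ} {k : ℕ} (hk : 2 ≤ k) (hlt : t k < t (k - 1)) {n : ℕ} (hn : 1 ≤ n) {s : ℝ}
    (hs : 0 ≤ s) :
    P.real ({ω | s < |empMass (fun i : Fin n => Y i ω) t k - popMass f t k|} ∪
      {ω | (t (k - 1) - t k) * s <
        |empMoment (fun i : Fin n => Y i ω) t k - popMoment f t k|}) ≤
      4 * Real.exp (-2 * (n * s ^ 2)) := by
  have hms := measurableSet_bin t k
  have h1 := measureReal_abs_empirical_sub_gt_le (P := P) hf hf0 hY hind hlaw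
    (φ := (bin t k).indicator fun _ => 1) (measurable_const.indicator hms) one_pos
    (fun x => by by_cases h : x ∈ bin t k <;> simp [h]) hn hs
  have h2 := measureReal_abs_empirical_sub_gt_le (P := P) hf hf0 hY hind hlaw
    (φ := (bin t k).indicator fun x => x - t k)
    ((measurable_id.sub_const _).indicator hms) (sub_pos.2 hlt)
    (fun x => by
      by_cases h : x ∈ bin t k
      · rw [Set.indicator_of_mem h]
        exact ⟨sub_nonneg.2 (le_of_mem_bin h), by linarith [lt_of_mem_bin (by omega) h]⟩
      · rw [Set.indicator_of_notMem h]
        exact ⟨le_rfl, (sub_pos.2 hlt).le⟩) hn hs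
  simp only [integral_mul_indicator _ _ hms, one_mul] at h1 h2
  refine (measureReal_union_le _ _).trans ?_
  have h3 := add_le_add h1 h2
  unfold empMass empMoment popMass popMoment
  linarith

/-- Outside a summable sequence of events, the empirical moments of all the bins that meet a
bounded set are uniformly close to the population moments. -/
lemma exists_deviation_events [IsProbabilityMeasure P] (hf : Measurable f)
    (hf0 : ∀ x, 0 ≤ f x) (hY : ∀ i, Measurable (Y i)) (hind : iIndepFun Y P)
    (hlaw : ∀ i, P.map (Y i) = volume.withDensity (fun x => ENNReal.ofReal (f x)))
    {K : ℕ → ℕ} {t : ℕ → ℕ → ℝ}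
    (ht_anti : ∀ n, 1 ≤ n → StrictAntiOn (t n) (Set.Icc 1 (K n)))
    {c₁ c₂ r₁ r₂ : ℝ} (hc₁ : 0 < c₁) (hc₂ : 0 < c₂) (hr₁ : 0 < r₁) (hr₂ : 0 < r₂)
    (ht_width : ∀ n, 1 ≤ n → ∀ k, 2 ≤ k → k ≤ K n →
      c₁ * (n : ℝ) ^ (-r₁) ≤ t n (k - 1) - t n k ∧ t n (k - 1) - t n k ≤ c₂ * (n : ℝ) ^ (-r₂))
    {C : Set ℝ} {A B : ℝ} (hC : C ⊆ Set.Icc A B) :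
    ∃ E : ℕ → Set Ω, ∑' n, P (E n) ≠ ⊤ ∧ ∀ n, 1 ≤ n → ∀ ω, ω ∉ E n →
      ∀ k ∈ Set.Icc 2 (K n), (bin (t n) k ∩ C).Nonempty →
      |empMass (fun i : Fin n => Y i ω) (t n) k - popMass f (t n) k| ≤ (n : ℝ) ^ (-(1 / 2) + r₁) ∧
      |empMoment (fun i : Fin n => Y i ω) (t n) k - popMoment f (t n) k| ≤
        (t n (k - 1) - t n k) * (n : ℝ) ^ (-(1 / 2) + r₁) := by
  classical
  -- With this choice `n * s n ^ 2 = n ^ (2 * r₁)`, so the tail beats the `O(n ^ r₁)` bins in the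
  -- union bound.
  set s : ℕ → ℝ := fun n => (n : ℝ) ^ (-(1 / 2) + r₁) with hs
  set F : ℕ → ℕ → Set Ω := fun n k =>
    {ω | s n < |empMass (fun i : Fin n => Y i ω) (t n) k - popMass f (t n) k|} ∪
      {ω | (t n (k - 1) - t n k) * s n <
        |empMoment (fun i : Fin n => Y i ω) (t n) k - popMoment f (t n) k|} with hF
  set S : ℕ → Finset ℕ := fun n =>
    (Finset.Icc 2 (K n)).filter fun k => (bin (t n) k ∩ C).Nonempty with hS
  set E : ℕ → Set Ω := fun n => if 1 ≤ n then ⋃ k ∈ S n, F n k else ∅ with hE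
  set W := max (B - A + 2 * c₂) 0 / c₁ * 4 with hW
  have hbound : ∀ n, P (E n) ≤
      ENNReal.ofReal (W * (n : ℝ) ^ r₁ * Real.exp (-2 * (n : ℝ) ^ (2 * r₁))) := by
    intro n
    by_cases hn : 1 ≤ n
    swap
    · simp [hE, hn]
    have hn' : (0 : ℝ) < n := by exact_mod_cast hn
    have hn1 : (1 : ℝ) ≤ n := by exact_mod_cast hn
    have hSmem : ∀ k ∈ S n, k ∈ Set.Icc 2 (K n) ∧ (bin (t n) k ∩ C).Nonempty := by
      intro k hk
      simpa [hS] using hk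
    have hw : ∀ k ∈ Set.Icc 2 (K n), c₁ * (n : ℝ) ^ (-r₁) ≤ t n (k - 1) - t n k ∧
        t n (k - 1) - t n k ≤ c₂ := by
      intro k hk
      have h := ht_width n hn k hk.1 hk.2
      refine ⟨h.1, h.2.trans ?_⟩
      have : (n : ℝ) ^ (-r₂) ≤ 1 := Real.rpow_le_one_of_one_le_of_nonpos hn1 (by linarith)
      nlinarith
    have hcard := card_bins_mul_le (ht_anti n hn) hC hw hSmem
    have hns : (n : ℝ) * s n ^ 2 = (n : ℝ) ^ (2 * r₁) := by
      simp only [hs]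
      rw [← Real.rpow_natCast, ← Real.rpow_mul hn'.le]
      nth_rewrite 1 [← Real.rpow_one (n : ℝ)]
      rw [← Real.rpow_add hn']
      congr 1
      push_cast
      ring
    have hFk : ∀ k ∈ S n, P.real (F n k) ≤ 4 * Real.exp (-2 * (n : ℝ) ^ (2 * r₁)) := by
      intro k hk
      have hk' := (hSmem k hk).1
      have hwk := (hw k hk').1
      have hp : 0 < c₁ * (n : ℝ) ^ (-r₁) := by positivity
      rw [← hns]
      exact measureReal_bin_deviation_le hf hf0 hY hind hlaw hk'.1 (by linarith) hn
        (by positivity)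
    have hEn : E n = ⋃ k ∈ S n, F n k := by simp [hE, hn]
    rw [hEn, ← ofReal_measureReal (measure_ne_top _ _)]
    refine ENNReal.ofReal_le_ofReal ((measureReal_biUnion_finset_le _ _).trans
      ((Finset.sum_le_card_nsmul _ _ _ hFk).trans ?_))
    rw [nsmul_eq_mul]
    have hcard' : ((S n).card : ℝ) ≤ max (B - A + 2 * c₂) 0 / c₁ * (n : ℝ) ^ r₁ := by
      rw [Real.rpow_neg hn'.le] at hcard
      have hp : 0 < (n : ℝ) ^ r₁ := by positivity
      have e : ((S n).card : ℝ) * (c₁ * ((n : ℝ) ^ r₁)⁻¹) =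
        (S n).card * c₁ / (n : ℝ) ^ r₁ := by field_simp
      rw [e, div_le_iff₀ hp] at hcard
      rw [div_mul_eq_mul_div, le_div_iff₀ hc₁]
      exact hcard
    have := mul_le_mul_of_nonneg_right hcard'
      (show 0 ≤ 4 * Real.exp (-2 * (n : ℝ) ^ (2 * r₁)) by positivity)
    refine this.trans (le_of_eq ?_)
    rw [hW]
    ring
  refine ⟨E, ?_, ?_⟩
  · exact ne_top_of_le_ne_top (summable_rpow_mul_exp_neg hr₁ W).tsum_ofReal_ne_top
      (ENNReal.tsum_le_tsum hbound)
  · intro n hn ω hω k hk hne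
    have hkS : k ∈ S n := by simpa [hS] using And.intro hk hne
    have hωF : ω ∉ F n k := fun h => hω (by
      simp only [hE, hn, if_true, Set.mem_iUnion]
      exact ⟨k, hkS, h⟩)
    simp only [hF, Set.mem_union, Set.mem_ofPred_eq, not_or, not_lt] at hωF
    exact hωF

end Probability

/-! ### Deterministic error bounds on a bin -/

section Deterministic

variable {f : ℝ → ℝ} {L : ℝ} {t : ℕ → ℝ} {K k : ℕ} {x δ B : ℝ}

lemma continuous_of_abs_sub_le (hf : ∀ x₁ x₂ : ℝ, |f x₁ - f x₂| ≤ L * |x₁ - x₂|) (hL : 0 < L) :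
    Continuous f :=
  (LipschitzWith.of_dist_le_mul (K := ⟨L, hL.le⟩) fun x₁ x₂ => by
    rw [Real.dist_eq, Real.dist_eq]; exact hf x₁ x₂).continuous

lemma abs_popMass_div_sub_le (hL : 0 < L) (hf : ∀ x₁ x₂ : ℝ, |f x₁ - f x₂| ≤ L * |x₁ - x₂|)
    (hk : 2 ≤ k) (hx : x ∈ bin t k) :
    |popMass f t k / (t (k - 1) - t k) - f x| ≤ L * (t (k - 1) - t k) := by
  have hc := continuous_of_abs_sub_le hf hL
  have ha := le_of_mem_bin hx
  have hb := lt_of_mem_bin (by omega) hx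
  set a := t k
  set b := t (k - 1)
  have hab : 0 < b - a := by linarith
  have e : popMass f t k - (b - a) * f x = ∫ z in a..b, (f z - f x) := by
    rw [intervalIntegral.integral_sub (by apply Continuous.intervalIntegrable; fun_prop) (by simp),
      popMass, bin_of_two_le t hk, integral_Ico_eq_integral_Ioc,
      ← intervalIntegral.integral_of_le (by linarith)]
    simp [a, b]
  have hI := intervalIntegral.norm_integral_le_of_norm_le_const (a := a) (b := b)
    (f := fun z => f z - f x) (C := L * (b - a)) fun z hz => by
      rw [Set.uIoc_of_le (by linarith)] at hz
      refine (hf z x).trans (mul_le_mul_of_nonneg_left ?_ hL.le)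
      rw [abs_le]; constructor <;> linarith [hz.1, hz.2]
  rw [← e, Real.norm_eq_abs, abs_of_pos hab] at hI
  rw [show popMass f t k / (b - a) - f x = (popMass f t k - (b - a) * f x) / (b - a) by field_simp,
    abs_div, abs_of_pos hab, div_le_iff₀ hab]
  exact hI

/-- A constant `f x` would give exactly `f x / 2`, and replacing `f z` by `f x` costs at most `L`
times the width. -/
lemma abs_popMoment_div_sub_le (hL : 0 < L) (hf : ∀ x₁ x₂ : ℝ, |f x₁ - f x₂| ≤ L * |x₁ - x₂|)
    (hk : 2 ≤ k) (hx : x ∈ bin t k) :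
    |popMoment f t k / (t (k - 1) - t k) ^ 2 - f x / 2| ≤ L * (t (k - 1) - t k) := by
  have hc := continuous_of_abs_sub_le hf hL
  have ha := le_of_mem_bin hx
  have hb := lt_of_mem_bin (by omega) hx
  set a := t k with ha_def
  set b := t (k - 1)
  have hab : 0 < b - a := by linarith
  have hlin : ∫ z in a..b, (z - a) * f x = (b - a) ^ 2 * (f x / 2) := by
    rw [intervalIntegral.integral_mul_const,
      intervalIntegral.integral_comp_sub_right (fun z : ℝ => z) a, integral_id]
    ring
  have e : popMoment f t k - (b - a) ^ 2 * (f x / 2) = ∫ z in a..b, (z - a) * (f z - f x) := by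
    have e1 : ∀ z, (z - a) * (f z - f x) = (z - a) * f z - (z - a) * f x := fun z => mul_sub _ _ _
    simp_rw [e1]
    rw [intervalIntegral.integral_sub (by apply Continuous.intervalIntegrable; fun_prop)
      (by apply Continuous.intervalIntegrable; fun_prop), hlin,
      popMoment, bin_of_two_le t hk, integral_Ico_eq_integral_Ioc,
      ← intervalIntegral.integral_of_le (by linarith)]
  have hI := intervalIntegral.norm_integral_le_of_norm_le_const (a := a) (b := b)
    (f := fun z => (z - a) * (f z - f x)) (C := (b - a) * (L * (b - a))) fun z hz => by
      rw [Set.uIoc_of_le (by linarith)] at hz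
      rw [norm_mul, Real.norm_eq_abs, Real.norm_eq_abs, abs_of_pos (by linarith [hz.1])]
      refine mul_le_mul (by linarith [hz.2]) ((hf z x).trans
        (mul_le_mul_of_nonneg_left ?_ hL.le)) (abs_nonneg _) hab.le
      rw [abs_le]; constructor <;> linarith [hz.1, hz.2]
  rw [← e, Real.norm_eq_abs, abs_of_pos hab] at hI
  rw [show popMoment f t k / (b - a) ^ 2 - f x / 2 =
    (popMoment f t k - (b - a) ^ 2 * (f x / 2)) / (b - a) ^ 2 by field_simp,
    abs_div, abs_of_pos (pow_pos hab 2), div_le_iff₀ (pow_pos hab 2)]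
  linarith

lemma glue_piece_of_mem (ht : StrictAntiOn t (Set.Icc 1 K)) (m₀ m₁ : ℕ → ℝ)
    (hk : k ∈ Set.Icc 2 K) (hx : x ∈ bin t k) :
    glue K t (piece t m₀ m₁) x = binDensity (t k) (t (k - 1) - t k) (m₀ k) (m₁ k) x := by
  have h2 := hk.1
  rw [glue_of_mem ht _ ⟨by omega, hk.2⟩ hx, piece, if_neg (by omega)]

lemma sub_div_mem_Icc (hk : 2 ≤ k) (hx : x ∈ bin t k) :
    (x - t k) / (t (k - 1) - t k) ∈ Set.Icc (0 : ℝ) 1 := by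
  have ha := le_of_mem_bin hx
  have hb := lt_of_mem_bin (by omega) hx
  have hab : 0 < t (k - 1) - t k := by linarith
  exact ⟨div_nonneg (by linarith) hab.le, (div_le_one hab).2 (by linarith)⟩

/-- Approximation error of the maximum entropy density built from population moments. -/
lemma abs_glue_pop_sub_le (hL : 0 < L) (hf : ∀ x₁ x₂ : ℝ, |f x₁ - f x₂| ≤ L * |x₁ - x₂|)
    (ht : StrictAntiOn t (Set.Icc 1 K)) (hk : k ∈ Set.Icc 2 K) (hx : x ∈ bin t k) (hδ : 0 < δ)
    (hfδ : δ ≤ f x) (hfB : f x ≤ B) (hh : L * (t (k - 1) - t k) ≤ δ / 288) :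
    |glue K t (piece t (popMass f t) (popMoment f t)) x - f x| ≤
      (9 + 38880 * B / δ) * (L * (t (k - 1) - t k)) := by
  -- The reference pair is `(f x, f x / 2)`, whose tilted density is the constant `f x`.
  have h := abs_mul_tiltDensity_sub_le hδ hfδ hfB (abs_popMass_div_sub_le hL hf hk.1 hx)
    (abs_popMoment_div_sub_le hL hf hk.1 hx) (by simp; positivity) hh (sub_div_mem_Icc hk.1 hx)
  have e : f x / 2 / f x = 1 / 2 := by have := (hδ.trans_le hfδ).ne'; field_simp
  rw [e, tiltDensity_half, mul_one] at h
  rw [glue_piece_of_mem ht _ _ hk hx]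
  exact h

/-- Stability of the maximum entropy density around the population moments. -/
lemma abs_glue_sub_glue_pop_le (hL : 0 < L)
    (hf : ∀ x₁ x₂ : ℝ, |f x₁ - f x₂| ≤ L * |x₁ - x₂|)
    (ht : StrictAntiOn t (Set.Icc 1 K)) (hk : k ∈ Set.Icc 2 K) (hx : x ∈ bin t k) (hδ : 0 < δ)
    (hfδ : δ ≤ f x) (hfB : f x ≤ B) (hh : L * (t (k - 1) - t k) ≤ δ / 288) {m₀ m₁ : ℕ → ℝ} {s : ℝ}
    (hm₀ : |m₀ k - popMass f t k| ≤ s)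
    (hm₁ : |m₁ k - popMoment f t k| ≤ (t (k - 1) - t k) * s)
    (hs : s / (t (k - 1) - t k) ≤ δ / 576) :
    |glue K t (piece t m₀ m₁) x - glue K t (piece t (popMass f t) (popMoment f t)) x| ≤
      (9 + 38880 * (B + δ) / (δ / 2)) * (s / (t (k - 1) - t k)) := by
  have hQ := abs_popMass_div_sub_le hL hf hk.1 hx
  have hN := abs_popMoment_div_sub_le hL hf hk.1 hx
  have ha := le_of_mem_bin hx
  have hb := lt_of_mem_bin (by have := hk.1; omega) hx
  have hu := sub_div_mem_Icc hk.1 hx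
  rw [glue_piece_of_mem ht _ _ hk hx, glue_piece_of_mem ht _ _ hk hx]
  unfold binDensity
  set h := t (k - 1) - t k
  have hpos : 0 < h := by simp only [h]; linarith
  rw [abs_le] at hQ hN
  -- The reference is now the population pair, whose scaled mass is only known to lie in `[δ / 2, B
  -- + δ]`. So `δ / 2` replaces `δ`, and the tolerance `δ / 288` becomes `δ / 576`.
  refine abs_mul_tiltDensity_sub_le (by positivity) (by linarith) (by linarith) ?_ ?_ ?_ ?_ hu
  · rw [← sub_div, abs_div, abs_of_pos hpos]
    exact div_le_div_of_nonneg_right hm₀ hpos.le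
  · rw [← sub_div, abs_div, abs_of_pos (pow_pos hpos 2), div_le_div_iff₀ (pow_pos hpos 2) hpos]
    nlinarith
  · rw [abs_le]; constructor <;> linarith
  · linarith

end Deterministic

/-! ### Suprema over the compact set and its position among the thresholds -/

lemma abs_iSup_sub_iSup_le {ι : Type*} {u v : ι → ℝ} {η : ℝ} (hu : ∀ i, 0 ≤ u i)
    (hv : ∀ i, 0 ≤ v i) (hub : BddAbove (Set.range u)) (hvb : BddAbove (Set.range v))
    (hη : 0 ≤ η) (h : ∀ i, |u i - v i| ≤ η) : |(⨆ i, u i) - ⨆ i, v i| ≤ η := by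
  -- Nonnegativity of the bound covers an empty index type, where the real supremum is `0`.
  have h1 : ⨆ i, u i ≤ (⨆ i, v i) + η :=
    Real.iSup_le (fun i => by linarith [(abs_le.1 (h i)).2, le_ciSup hvb i])
      (add_nonneg (Real.iSup_nonneg hv) hη)
  have h2 : ⨆ i, v i ≤ (⨆ i, u i) + η :=
    Real.iSup_le (fun i => by linarith [(abs_le.1 (h i)).1, le_ciSup hub i])
      (add_nonneg (Real.iSup_nonneg hu) hη)
  rw [abs_le]
  constructor <;> linarith

/-- A compact subset of `{f > 0}` eventually lies strictly between the extreme thresholds. -/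
lemma eventually_forall_mem_between {f : ℝ → ℝ} (hf : Continuous f) {K : ℕ → ℕ} {t : ℕ → ℕ → ℝ}
    (ht_lower : limsup (fun n => ((t n (K n) : ℝ) : EReal)) atTop ≤
      ⨅ x ∈ {x : ℝ | 0 < f x}, (x : EReal))
    (ht_upper : (⨆ x ∈ {x : ℝ | 0 < f x}, (x : EReal)) ≤
      liminf (fun n => ((t n 1 : ℝ) : EReal)) atTop)
    {C : Set ℝ} (hC : IsCompact C) (hCD : C ⊆ {x : ℝ | 0 < f x}) :
    ∀ᶠ n in atTop, ∀ x ∈ C, t n (K n) ≤ x ∧ x < t n 1 := by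
  rcases C.eq_empty_or_nonempty with rfl | hne
  · simp
  obtain ⟨a, ha, hamin⟩ := hC.exists_isLeast hne
  obtain ⟨b, hb, hbmax⟩ := hC.exists_isGreatest hne
  have hpos : ∀ c ∈ C, ∀ᶠ z in 𝓝 c, 0 < f z := fun c hc =>
    hf.continuousAt.eventually (lt_mem_nhds (hCD hc))
  -- The set `{f > 0}` is open, so it has points strictly beyond the extremes of `C`; these make the
  -- limit inequalities strict.
  obtain ⟨a', ha'a, ha'⟩ := (((hpos a ha).filter_mono nhdsWithin_le_nhds).and
    (self_mem_nhdsWithin (s := Set.Iio a))).exists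
  obtain ⟨b', hb'b, hb'⟩ := (((hpos b hb).filter_mono nhdsWithin_le_nhds).and
    (self_mem_nhdsWithin (s := Set.Ioi b))).exists
  have h1 : limsup (fun n => ((t n (K n) : ℝ) : EReal)) atTop < (a : EReal) :=
    (ht_lower.trans (iInf₂_le a' ha'a)).trans_lt (EReal.coe_lt_coe_iff.2 ha')
  have h2 : (b : EReal) < liminf (fun n => ((t n 1 : ℝ) : EReal)) atTop :=
    (EReal.coe_lt_coe_iff.2 hb').trans_le ((le_iSup₂ (f := fun (x : ℝ) (_ : x ∈ {x : ℝ | 0 < f x})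
      => (x : EReal)) b' hb'b).trans ht_upper)
  filter_upwards [eventually_lt_of_limsup_lt h1, eventually_lt_of_lt_liminf h2] with n hn1 hn2 x hx
  exact ⟨(EReal.coe_lt_coe_iff.1 hn1).le.trans (hamin hx),
    (hbmax hx).trans_lt (EReal.coe_lt_coe_iff.1 hn2)⟩

lemma exists_bounds_on_compact {f : ℝ → ℝ} (hf : Continuous f) {C : Set ℝ} (hC : IsCompact C)
    (hCD : C ⊆ {x : ℝ | 0 < f x}) : ∃ δ B, 0 < δ ∧ 0 < B ∧ ∀ x ∈ C, δ ≤ f x ∧ f x ≤ B := by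
  rcases C.eq_empty_or_nonempty with rfl | hne
  · exact ⟨1, 1, one_pos, one_pos, by simp⟩
  obtain ⟨a, ha, hamin⟩ := hC.exists_isMinOn hne hf.continuousOn
  obtain ⟨b, hb, hbmax⟩ := hC.exists_isMaxOn hne hf.continuousOn
  exact ⟨f a, f b, hCD ha, hCD hb, fun x hx => ⟨hamin hx, hbmax hx⟩⟩

lemma tendsto_natCast_rpow_neg {r : ℝ} (hr : 0 < r) :
    Tendsto (fun n : ℕ => (n : ℝ) ^ (-r)) atTop (𝓝 0) :=
  (tendsto_rpow_neg_atTop hr).comp tendsto_natCast_atTop_atTop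

end TabulatedME

end

/-! ### Consistency and rate of the estimator -/

theorem theorem1
    {Ω : Type*} [MeasurableSpace Ω] (P : Measure Ω) [IsProbabilityMeasure P]
    -- an i.i.d. sequence with density `f`
    (f : ℝ → ℝ) (Y : ℕ → Ω → ℝ)
    (hf_nonneg : ∀ x, 0 ≤ f x)
    (hY_meas : ∀ i, Measurable (Y i))
    (hY_indep : iIndepFun Y P)
    (hY_law : ∀ i, P.map (Y i) = volume.withDensity (fun x => ENNReal.ofReal (f x)))
    -- `f` is Lipschitz
    (L : ℝ) (hL : 0 < L) (hf_lip : ∀ x₁ x₂ : ℝ, |f x₁ - f x₂| ≤ L * |x₁ - x₂|)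
    -- for each sample size `n`, thresholds `t n 1 > t n 2 > ⋯ > t n (K n)`
    (K : ℕ → ℕ) (t : ℕ → ℕ → ℝ)
    (hK : ∀ n, 1 ≤ n → 1 ≤ K n)
    (ht_anti : ∀ n, 1 ≤ n → StrictAntiOn (t n) (Set.Icc 1 (K n)))
    -- bin widths
    (c₁ c₂ r₁ r₂ : ℝ) (hc₁ : 0 < c₁) (hc₂ : 0 < c₂)
    (hr₂ : 0 < r₂) (hr₂₁ : r₂ ≤ r₁) (hr₁ : r₁ < 1 / 4)
    (ht_width : ∀ n, 1 ≤ n → ∀ k, 2 ≤ k → k ≤ K n →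
      c₁ * (n : ℝ) ^ (-r₁) ≤ t n (k - 1) - t n k ∧
      t n (k - 1) - t n k ≤ c₂ * (n : ℝ) ^ (-r₂))
    -- the thresholds asymptotically cover `D = {f > 0}` (inequalities in `[-∞, ∞]`)
    (ht_lower : limsup (fun n => ((t n (K n) : ℝ) : EReal)) atTop ≤
      ⨅ x ∈ {x : ℝ | 0 < f x}, (x : EReal))
    (ht_upper : (⨆ x ∈ {x : ℝ | 0 < f x}, (x : EReal)) ≤
      liminf (fun n => ((t n 1 : ℝ) : EReal)) atTop)
    -- a compact subset of `D`
    (C : Set ℝ) (hC : IsCompact C) (hCD : C ⊆ {x : ℝ | 0 < f x}) :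
    let fHat : ℕ → Ω → ℝ → ℝ := fun n ω =>
      TabulatedME.meEstimator (K n) (t n) (fun i : Fin n => Y i ω)
    let supErr : ℕ → Ω → ℝ := fun n ω => ⨆ x : C, |fHat n ω x - f x|
    -- the estimator is well defined, as the unique solution of the maximum entropy problem,
    -- and the supremum is finite
    (∀ᵐ ω ∂P, ∀ n, 1 ≤ n →
      TabulatedME.IsMEDensity (K n) (t n)
        (TabulatedME.qHat (fun i : Fin n => Y i ω) (t n))
        (TabulatedME.yHat (fun i : Fin n => Y i ω) (t n)) (fHat n ω) ∧
      (∀ g : ℝ → ℝ, TabulatedME.IsMESolution (K n) (t n)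
          (TabulatedME.qHat (fun i : Fin n => Y i ω) (t n))
          (TabulatedME.yHat (fun i : Fin n => Y i ω) (t n)) g →
        g =ᵐ[volume.restrict (Set.Ici (t n (K n)))] fHat n ω) ∧
      BddAbove (Set.range (fun x : C => |fHat n ω x - f x|))) ∧
    -- strong uniform consistency
    (∀ᵐ ω ∂P, Tendsto (fun n => supErr n ω) atTop (𝓝 0)) ∧
    -- rate: deterministic part plus stochastic part
    (∃ (d : ℕ → ℝ) (R : ℕ → Ω → ℝ),
      (∀ n ω, supErr n ω = d n + R n ω) ∧
      d =O[atTop] (fun n : ℕ => (n : ℝ) ^ (-r₂)) ∧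
      TabulatedME.IsBigOInProb P R (fun n : ℕ => (n : ℝ) ^ (-((1 - 4 * r₁) / 2)))) := by
  intro fHat supErr
  have hf_cont := TabulatedME.continuous_of_abs_sub_le hf_lip hL
  have hr₁0 : 0 < r₁ := hr₂.trans_le hr₂₁
  obtain ⟨δ, B, hδ, hB, hfC⟩ := TabulatedME.exists_bounds_on_compact hf_cont hC hCD
  obtain ⟨A₀, A₁, hA⟩ : ∃ A₀ A₁, C ⊆ Set.Icc A₀ A₁ :=
    ⟨_, _, hC.isBounded.subset_Icc_sInf_sSup⟩
  obtain ⟨E, hE, hdev⟩ := TabulatedME.exists_deviation_events (P := P) hf_cont.measurable hf_nonneg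
    hY_meas hY_indep hY_law ht_anti hc₁ hc₂ hr₁0 hr₂ ht_width hA
  have hties := TabulatedME.ae_forall_ne_of_law hY_meas hY_law t
  -- The maximum entropy density of the population moments separates the deterministic from the
  -- random error.
  set fPop : ℕ → ℝ → ℝ := fun n => TabulatedME.glue (K n) (t n)
    (TabulatedME.piece (t n) (TabulatedME.popMass f (t n)) (TabulatedME.popMoment f (t n)))
    with hfPop
  set d : ℕ → ℝ := fun n => ⨆ x : C, |fPop n x - f x| with hd
  set b : ℕ → ℝ := fun n => (n : ℝ) ^ (-((1 - 4 * r₁) / 2)) with hb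
  have hb0 : ∀ n, 0 ≤ b n := fun n => by positivity
  set M₀ := (9 + 38880 * B / δ) * (L * c₂) with hM₀
  set M₁ := (9 + 38880 * (B + δ) / (δ / 2)) * (1 / c₁) with hM₁
  have hM₀0 : 0 < M₀ := by positivity
  have hM₁0 : 0 < M₁ := by positivity
  have hlim₂ := TabulatedME.tendsto_natCast_rpow_neg hr₂
  have hlimb : Tendsto b atTop (𝓝 0) :=
    TabulatedME.tendsto_natCast_rpow_neg (by linarith : 0 < (1 - 4 * r₁) / 2)
  have hsmall₂ : ∀ᶠ n : ℕ in atTop, L * (c₂ * (n : ℝ) ^ (-r₂)) < δ / 288 := by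
    have : Tendsto (fun n : ℕ => L * (c₂ * (n : ℝ) ^ (-r₂))) atTop (𝓝 0) := by
      simpa using (hlim₂.const_mul c₂).const_mul L
    exact this.eventually (gt_mem_nhds (by positivity))
  have hsmallb : ∀ᶠ n : ℕ in atTop, 1 / c₁ * b n < δ / 576 := by
    have : Tendsto (fun n : ℕ => 1 / c₁ * b n) atTop (𝓝 0) := by
      simpa using hlimb.const_mul (1 / c₁)
    exact this.eventually (gt_mem_nhds (by positivity))
  have hgood : ∀ᶠ n : ℕ in atTop, 1 ≤ n ∧ (∀ x ∈ C, |fPop n x - f x| ≤ M₀ * (n : ℝ) ^ (-r₂)) ∧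
      ∀ ω, ω ∉ E n → (∀ i n k, Y i ω ≠ t n k) → ∀ x ∈ C, |fHat n ω x - fPop n x| ≤ M₁ * b n := by
    filter_upwards [eventually_ge_atTop 1, hsmall₂, hsmallb,
      TabulatedME.eventually_forall_mem_between hf_cont ht_lower ht_upper hC hCD]
      with n hn h₂ hbn hbet
    have hn' : (0 : ℝ) < n := by exact_mod_cast hn
    have hbin : ∀ x ∈ C, ∃ k ∈ Set.Icc 2 (K n), x ∈ TabulatedME.bin (t n) k := by
      intro x hx
      obtain ⟨k, hk, hxk⟩ := TabulatedME.exists_mem_bin (hK n hn) (hbet x hx).1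
      refine ⟨k, ⟨?_, hk.2⟩, hxk⟩
      -- The top bin is excluded, since `C` lies below `t n 1`.
      by_contra hcon
      have h1 : k = 1 := by have := hk.1; omega
      subst h1
      exact absurd (TabulatedME.le_of_mem_bin hxk) (not_le.2 (hbet x hx).2)
    refine ⟨hn, fun x hx => ?_, fun ω hω hne x hx => ?_⟩
    all_goals
      obtain ⟨k, hk, hxk⟩ := hbin x hx
      have hw := ht_width n hn k hk.1 hk.2
      have hLw : L * (t n (k - 1) - t n k) ≤ L * (c₂ * (n : ℝ) ^ (-r₂)) :=
        mul_le_mul_of_nonneg_left hw.2 hL.le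
    · refine (TabulatedME.abs_glue_pop_sub_le hL hf_lip (ht_anti n hn) hk hxk hδ (hfC x hx).1
        (hfC x hx).2 (hLw.trans h₂.le)).trans ?_
      refine (mul_le_mul_of_nonneg_left hLw (by positivity)).trans (le_of_eq ?_)
      rw [hM₀]
      ring
    · have hdv := hdev n hn ω hω k hk ⟨x, hxk, hx⟩
      -- Dividing by the smallest width costs a second factor `n ^ r₁`, which turns the exponent
      -- into `-1/2 + 2 * r₁`.
      have hsn : (n : ℝ) ^ (-(1 / 2) + r₁) / (t n (k - 1) - t n k) ≤ 1 / c₁ * b n := by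
        have hp : 0 < c₁ * (n : ℝ) ^ (-r₁) := by positivity
        refine (div_le_div_of_nonneg_left (by positivity) hp hw.1).trans (le_of_eq ?_)
        have e : b n = (n : ℝ) ^ (-(1 / 2) + r₁) / (n : ℝ) ^ (-r₁) := by
          rw [← Real.rpow_sub hn']
          simp only [hb]
          congr 1
          ring
        rw [e]
        field_simp
      have hEq : fHat n ω = TabulatedME.glue (K n) (t n) (TabulatedME.piece (t n)
          (TabulatedME.empMass (fun i : Fin n => Y i ω) (t n))
          (TabulatedME.empMoment (fun i : Fin n => Y i ω) (t n))) :=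
        TabulatedME.meEstimator_eq_glue hn (hK n hn) (ht_anti n hn) fun i k _ => hne i n k
      rw [hEq]
      refine (TabulatedME.abs_glue_sub_glue_pop_le hL hf_lip (ht_anti n hn) hk hxk hδ
        (hfC x hx).1 (hfC x hx).2 (hLw.trans h₂.le) hdv.1 hdv.2 (hsn.trans hbn.le)).trans ?_
      refine (mul_le_mul_of_nonneg_left hsn (by positivity)).trans (le_of_eq ?_)
      rw [hM₁]
      ring
  -- For small `n` the set `C` may meet any bin, so the bound comes from boundedness of all the
  -- pieces and is not uniform in `n`.
  have hbdd : ∀ n, 1 ≤ n → ∀ ω, (∀ i n k, Y i ω ≠ t n k) →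
      BddAbove (Set.range (fun x : C => |fHat n ω x - f x|)) := by
    intro n hn ω hne
    obtain ⟨B', hB'⟩ := TabulatedME.exists_abs_meEstimator_le (y := fun i : Fin n => Y i ω) hn
      (hK n hn) (ht_anti n hn) fun i k _ => hne i n k
    refine ⟨B' + B, ?_⟩
    rintro _ ⟨x, rfl⟩
    have h1 := hfC x x.2
    refine (abs_sub _ _).trans (add_le_add (hB' x) ?_)
    rw [abs_of_nonneg (hf_nonneg x)]
    exact h1.2
  have hd_le : ∀ᶠ n : ℕ in atTop, 0 ≤ d n ∧ d n ≤ M₀ * (n : ℝ) ^ (-r₂) := by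
    filter_upwards [hgood] with n hn
    exact ⟨Real.iSup_nonneg fun x => abs_nonneg _,
      Real.iSup_le (fun x => hn.2.1 x x.2) (by positivity)⟩
  have hR_le : ∀ᶠ n : ℕ in atTop, ∀ ω, ω ∉ E n → (∀ i n k, Y i ω ≠ t n k) →
      |supErr n ω - d n| ≤ M₁ * b n := by
    filter_upwards [hgood] with n hn ω hω hne
    refine TabulatedME.abs_iSup_sub_iSup_le (fun _ => abs_nonneg _) (fun _ => abs_nonneg _)
      (hbdd n hn.1 ω hne) ⟨M₀ * (n : ℝ) ^ (-r₂), ?_⟩ (mul_nonneg hM₁0.le (hb0 n)) fun x => ?_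
    · rintro _ ⟨x, rfl⟩
      exact hn.2.1 x x.2
    · refine (abs_abs_sub_abs_le _ _).trans ?_
      rw [sub_sub_sub_cancel_right]
      exact hn.2.2 ω hω hne x x.2
  have hd0 : Tendsto d atTop (𝓝 0) := by
    refine tendsto_of_tendsto_of_tendsto_of_le_of_le' tendsto_const_nhds
      (by simpa using hlim₂.const_mul M₀) (hd_le.mono fun n h => h.1) (hd_le.mono fun n h => h.2)
  refine ⟨?_, ?_, d, fun n ω => supErr n ω - d n, fun n ω => by ring, ?_, ?_⟩
  · filter_upwards [hties] with ω hne n hn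
    have hG : ∀ k ∈ Set.Icc 1 (K n), TabulatedME.IsExpPiece (TabulatedME.bin (t n) k)
        (TabulatedME.qHat (fun i : Fin n => Y i ω) (t n) k)
        (TabulatedME.yHat (fun i : Fin n => Y i ω) (t n) k)
        (TabulatedME.piece (t n) (TabulatedME.empMass (fun i : Fin n => Y i ω) (t n))
          (TabulatedME.empMoment (fun i : Fin n => Y i ω) (t n)) k) := fun k hk =>
      TabulatedME.isExpPiece_piece hn (ht_anti n hn) hk fun i => hne i n k
    have hEq : fHat n ω = TabulatedME.glue (K n) (t n) (TabulatedME.piece (t n)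
        (TabulatedME.empMass (fun i : Fin n => Y i ω) (t n))
        (TabulatedME.empMoment (fun i : Fin n => Y i ω) (t n))) :=
      TabulatedME.meDensity_eq_glue (hK n hn) (ht_anti n hn) hG
    refine ⟨?_, fun g hg => ?_, hbdd n hn ω hne⟩
    · rw [hEq]
      exact TabulatedME.isMEDensity_glue (hK n hn) (ht_anti n hn) hG
    · rw [hEq]
      exact hg.ae_eq_glue (hK n hn) (ht_anti n hn) hG
  -- Borel–Cantelli: almost surely only finitely many of the events `E n` occur.
  · filter_upwards [hties, ae_eventually_notMem hE] with ω hne hω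
    have hR0 : Tendsto (fun n => supErr n ω - d n) atTop (𝓝 0) := by
      refine squeeze_zero_norm' ?_ (by simpa using hlimb.const_mul M₁)
      filter_upwards [hR_le, hω] with n hn hωn
      exact hn ω hωn hne
    simpa using hR0.add hd0
  · refine IsBigO.of_bound M₀ ?_
    filter_upwards [hd_le] with n hn
    rw [Real.norm_of_nonneg hn.1, Real.norm_of_nonneg (by positivity)]
    exact hn.2
  -- The same constant `M₁` serves every `ε`, because `P (E n)` tends to zero.
  · intro ε hε
    refine ⟨M₁, hM₁0, ?_⟩
    have hEto : Tendsto (fun n => P (E n)) atTop (𝓝 0) :=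
      ENNReal.tendsto_atTop_zero_of_tsum_ne_top hE
    filter_upwards [hR_le, hEto.eventually (gt_mem_nhds (ENNReal.ofReal_pos.2 hε))] with n hn hPE
    have hsub : {ω | M₁ * |b n| < |supErr n ω - d n|} ⊆
        E n ∪ {ω | ¬ ∀ i n k, Y i ω ≠ t n k} := by
      intro ω hω
      by_contra hcon
      simp only [Set.mem_union, Set.mem_ofPred_eq, not_or, not_not] at hcon hω
      rw [abs_of_nonneg (hb0 n)] at hω
      exact absurd (hn ω hcon.1 hcon.2) (not_le.2 hω)
    calc P _ ≤ P _ := measure_mono hsub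
      _ ≤ P (E n) + P {ω | ¬ ∀ i n k, Y i ω ≠ t n k} := measure_union_le _ _
      _ = P (E n) := by rw [ae_iff.1 hties, add_zero]
      _ ≤ _ := hPE.le
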